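/- Let $M$ be a matroid on the ground set $[n]=\{1,\dots,n\}$ of rank $r\ge 2$. Let $f_M=\sum_{B}\prod_{i\in B}x_i\in\mathbb R[x_1,\dots,x_n]$, the sum being over all bases $B$ of $M$, and for each integer $k\ge 0$ let $f_k=\sum_{I}\prod_{i\in I}x_i$, the sum being over all independent sets $I$ of $M$ with $|I|=k$ (so $f_r=f_M$ and $f_k=0$ for $k>r$). Write $\partial_i=\partial/\partial x_i$. A loop is an element forming a one-element circuit; two distinct elements are parallel if they form a two-element circuit; the parallel class of a non-loop $e$ consists of $e$ and all elements parallel to $e$. Let $\mathrm{girth}(M)$ be the minimum cardinality of a circuit of $M$ ($+\infty$ if $M$ has no circuit). (i) If $i,j\in[n]$ are non-loops and $M$ has at least three parallel classes, then for every $\mathbf a\in\mathbb R_{>0}^n$ $$f_M(\mathbf a)\cdot\partial_i\partial_j f_M(\mathbf a)<2\Bigl(1-\frac1r\Bigr)\,\partial_i f_M(\mathbf a)\cdot\partial_j f_M(\mathbf a).$$ (ii) For every integer $k$ with $1\le k\le r$ and $k+1\ge\mathrm{girth}(M)$, and every $\mathbf a\in\mathbb R_{>0}^n$, $$\frac{f_{k-1}(\mathbf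 a)}{\binom n{k-1}}\cdot\frac{f_{k+1}(\mathbf a)}{\binom n{k+1}}<\left(\frac{f_k(\mathbf a)}{\binom nk}\right)^2 .$$ -/

import Mathlib

namespace Matroid

open Classical in
/-- The homogeneous degree `k` independent set generating polynomial
`f_k = ∑_{I independent, |I| = k} ∏_{i ∈ I} x_i`. -/
noncomputable def indepPoly {n : ℕ} (M : Matroid (Fin n)) (k : ℕ) : MvPolynomial (Fin n) ℝ :=
  ∑ I ∈ Finset.univ.filter
      (fun I : Finset (Fin n) => M.Indep (I : Set (Fin n)) ∧ I.card = k),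
    ∏ i ∈ I, MvPolynomial.X i

open Classical in
/-- The basis generating polynomial `f_M = ∑_{B basis} ∏_{i ∈ B} x_i`. -/
noncomputable def basisPoly {n : ℕ} (M : Matroid (Fin n)) : MvPolynomial (Fin n) ℝ :=
  ∑ B ∈ Finset.univ.filter (fun B : Finset (Fin n) => M.IsBase (B : Set (Fin n))),
    ∏ i ∈ B, MvPolynomial.X i

/-- Two distinct elements are parallel if they form a circuit with two elements. -/
def IsParallel {α : Type*} (M : Matroid α) (e f : α) : Prop :=
  e ≠ f ∧ M.IsCircuit {e, f}

/-- The parallel classes of a matroid: the class of a non-loop `e` consists of `e` and of all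
elements parallel to `e`. Loops lie in no parallel class. -/
def parallelClasses {α : Type*} (M : Matroid α) : Set (Set α) :=
  {P | ∃ e, M.IsNonloop e ∧ P = {f | f = e ∨ M.IsParallel e f}}

/-- The girth of a matroid: the minimum cardinality of a circuit, `⊤` if there is no circuit. -/
noncomputable def girth {α : Type*} (M : Matroid α) : ℕ∞ :=
  ⨅ (C : Set α) (_ : M.IsCircuit C), C.encard

end Matroid

/-!
Both inequalities come from the Hessian of a generating polynomial having exactly one positive
eigenvalue at every positive point, together with a description of the kernel of that Hessian.

The coordinates are scaled so that the base point becomes `1`. The iterated derivative along `S` of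
the generating polynomial of the independent sets of size `d` is then encoded by weighted counts of
the independent sets containing `S`: `indepSum`, its gradient `linkDeg` and its Hessian
`linkMatrix`. Euler's identity says that the matrix for `S` is, up to a factor, the sum of the
matrices for the sets `insert l S`.

*One positive eigenvalue* (`hyperbolicAt_linkMatrix`). If `S` has corank two, that is `d - 2`
elements, the Hessian is that of the quadric `∑ y_P y_Q` over pairs of distinct parallel classes
`P`, `Q` of the contraction of `S`, and the claim is a Cauchy–Schwarz inequality. For smaller `S`
it trickles down. The reversed Cauchy–Schwarz inequalities for the sets `insert l S` add up to
`c B ≤ B ^ 2` for the normalized Hessian `B`, whose largest eigenvalue is `c` and simple, so that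
all other eigenvalues are at most `0` (`Matrix.IsSymm.hyperbolicAt_one_of_gap`). A kernel vector of
the Hessian for `S` is also one for `insert l S` (`linkMatrix_insert_mulVec_eq_zero`), and in corank
two the sums of a kernel vector over the parallel classes vanish (`sum_linkVerts_eq_zero`).

*The inequality for two derivatives* (`mul_indepSum_pair_lt`). For `d = r` the reversed
Cauchy–Schwarz inequality for `1` and `f_j e_i + f_i e_j` is the weak inequality. Equality puts
`f_j e_i + f_i e_j - c 1`, with `c > 0`, into the kernel, which is impossible: some contraction of
rank two has a parallel class that contains neither `i` nor `j`.

*Mason's inequality* (`mul_indepSum_lt_sq`). With `d = k + 1` the Hessian is bordered by a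
homogenizing variable `y` (`borderMatrix`), at `y = 0`. There is a vector `w` with last coordinate
`1` that is orthogonal to all old variables, and it suffices that the bordered form is negative at
`w`. Such a vector exists for every `S`. In corank two the value at it is a positive multiple of
`p - (n - k + 1)`, where `p` is the number of parallel classes of the contraction; as `n - k + 1`
elements remain, this is at most `0`, so that the bordered form is hyperbolic. Both facts pass to
smaller `S` by Euler's identity, since `w` becomes orthogonal to the base point after contracting a
further element (`borderMatrix_nonpos_and_hyperbolicAt`). If the value is `0` for `S = ∅`, then `w`
is in the kernel of all contractions and `p = n - k + 1` for every independent `S` of size `k - 1`.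
Any two further elements then extend any such `S` to an independent set, which a circuit of size at
most `k + 1` excludes.
-/

open scoped Matrix

/-! ### Symmetric matrices with one positive direction -/

/-- If `T` has no eigenvalues strictly between `0` and `c`, and every eigenvector for an eigenvalue
at least `c` is a multiple of `e`, then the quadratic form of `T` is nonpositive on the orthogonal
complement of `e`. The hypothesis `c * T ≤ T ^ 2` provides the gap. -/
theorem LinearMap.IsSymmetric.inner_nonpos_of_eigenvalue_gap {E : Type*} [NormedAddCommGroup E]
    [InnerProductSpace ℝ E] [FiniteDimensional ℝ E] {T : E →ₗ[ℝ] E} (hT : T.IsSymmetric)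
    {c : ℝ} {e : E} (hgap : ∀ x, c * inner ℝ (T x) x ≤ inner ℝ (T x) (T x))
    (htop : ∀ x (μ : ℝ), 0 < μ → c ≤ μ → T x = μ • x → ∃ t : ℝ, x = t • e)
    {v : E} (hv : inner ℝ e v = 0) : inner ℝ (T v) v ≤ 0 := by
  set b := hT.eigenvectorBasis rfl with hb
  set ev := hT.eigenvalues rfl with hev
  have hTb : ∀ i, T (b i) = ev i • b i := fun i => hT.apply_eigenvectorBasis rfl i
  rw [← b.sum_inner_mul_inner]
  refine Finset.sum_nonpos fun i _ => ?_
  rw [hT, hTb, real_inner_smul_right, real_inner_comm, mul_assoc]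
  by_cases hi : ev i ≤ 0
  · exact mul_nonpos_of_nonpos_of_nonneg hi (mul_self_nonneg _)
  push Not at hi
  have h1 : inner ℝ (b i) (b i) = 1 := by
    rw [real_inner_self_eq_norm_sq, b.norm_eq_one]; norm_num
  have hc : c ≤ ev i := by
    have h := hgap (b i)
    rw [hTb, real_inner_smul_left, real_inner_smul_left, real_inner_smul_right, h1] at h
    simp only [mul_one] at h
    exact le_of_mul_le_mul_right h hi
  obtain ⟨t, ht⟩ := htop _ _ hi hc (hTb i)
  have h0 : inner ℝ (b i) v = 0 := by rw [ht, real_inner_smul_left, hv, mul_zero]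
  rw [h0]; simp

namespace Matrix

variable {ι : Type*} [Fintype ι]

/-- The quadratic form of `A` is nonpositive on the `A`-orthogonal complement of `e`. When
`e ⬝ᵥ A *ᵥ e > 0` and `A` is symmetric this says that `A` has exactly one positive eigenvalue. -/
def HyperbolicAt (A : Matrix ι ι ℝ) (e : ι → ℝ) : Prop :=
  ∀ v, e ⬝ᵥ A *ᵥ v = 0 → v ⬝ᵥ A *ᵥ v ≤ 0

theorem IsSymm.dotProduct_mulVec_comm {A : Matrix ι ι ℝ} (hA : A.IsSymm) (u v : ι → ℝ) :
    u ⬝ᵥ A *ᵥ v = v ⬝ᵥ A *ᵥ u := by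
  rw [dotProduct_mulVec, dotProduct_comm, ← mulVec_transpose, hA.eq]

theorem IsSymm.quadratic_add_smul {A : Matrix ι ι ℝ} (hA : A.IsSymm) (u v : ι → ℝ) (t : ℝ) :
    (u + t • v) ⬝ᵥ A *ᵥ (u + t • v) =
      u ⬝ᵥ A *ᵥ u + 2 * t * (u ⬝ᵥ A *ᵥ v) + t ^ 2 * (v ⬝ᵥ A *ᵥ v) := by
  simp only [mulVec_add, mulVec_smul, add_dotProduct, dotProduct_add, smul_dotProduct,
    dotProduct_smul, smul_eq_mul]
  rw [hA.dotProduct_mulVec_comm v u]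
  ring

/-- The reversed Cauchy–Schwarz inequality. -/
theorem HyperbolicAt.mul_le_sq {A : Matrix ι ι ℝ} {e : ι → ℝ} (h : A.HyperbolicAt e)
    (hA : A.IsSymm) (he : 0 < e ⬝ᵥ A *ᵥ e) (v : ι → ℝ) :
    (e ⬝ᵥ A *ᵥ e) * (v ⬝ᵥ A *ᵥ v) ≤ (e ⬝ᵥ A *ᵥ v) ^ 2 := by
  set p := e ⬝ᵥ A *ᵥ e with hp
  set q := e ⬝ᵥ A *ᵥ v with hq
  have h1 : e ⬝ᵥ A *ᵥ (v + (-(q / p)) • e) = 0 := by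
    rw [mulVec_add, mulVec_smul, dotProduct_add, dotProduct_smul, ← hp, ← hq, smul_eq_mul]
    field_simp
    ring
  have h2 := h _ h1
  rw [hA.quadratic_add_smul, hA.dotProduct_mulVec_comm v e, ← hp, ← hq] at h2
  have h3 : p * (v ⬝ᵥ A *ᵥ v + 2 * -(q / p) * q + (-(q / p)) ^ 2 * p) =
      p * (v ⬝ᵥ A *ᵥ v) - q ^ 2 := by
    field_simp
    ring
  nlinarith

/-- The equality case of the reversed Cauchy–Schwarz inequality on the orthogonal complement. -/
theorem HyperbolicAt.mulVec_eq_zero {A : Matrix ι ι ℝ} {e : ι → ℝ} (h : A.HyperbolicAt e)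
    (hA : A.IsSymm) (he : 0 < e ⬝ᵥ A *ᵥ e) {v : ι → ℝ} (hev : e ⬝ᵥ A *ᵥ v = 0)
    (hv : v ⬝ᵥ A *ᵥ v = 0) : A *ᵥ v = 0 := by
  have key : ∀ u, u ⬝ᵥ A *ᵥ v = 0 := by
    intro u
    have hineq : ∀ t : ℝ, (e ⬝ᵥ A *ᵥ e) * (u ⬝ᵥ A *ᵥ u + 2 * t * (u ⬝ᵥ A *ᵥ v)) ≤
        (e ⬝ᵥ A *ᵥ u) ^ 2 := by
      intro t
      have := h.mul_le_sq hA he (u + t • v)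
      rw [hA.quadratic_add_smul, hv, mulVec_add, mulVec_smul, dotProduct_add, dotProduct_smul,
        hev] at this
      simpa using this
    by_contra hne
    set p := e ⬝ᵥ A *ᵥ e
    set x := u ⬝ᵥ A *ᵥ v
    set z := u ⬝ᵥ A *ᵥ u
    set y := (e ⬝ᵥ A *ᵥ u) ^ 2
    have := hineq ((y - p * z + 1) / (2 * p * x))
    have h2 : p * (z + 2 * ((y - p * z + 1) / (2 * p * x)) * x) = y + 1 := by
      field_simp
      ring
    linarith
  have := key (A *ᵥ v)
  rwa [dotProduct_self_eq_zero] at this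

/-- The reversed Cauchy–Schwarz inequality is strict unless `v` is a multiple of `e` modulo the
kernel of `A`. -/
theorem HyperbolicAt.mul_lt_sq {A : Matrix ι ι ℝ} {e : ι → ℝ} (h : A.HyperbolicAt e)
    (hA : A.IsSymm) (he : 0 < e ⬝ᵥ A *ᵥ e) {v : ι → ℝ}
    (hv : A *ᵥ (v + (-((e ⬝ᵥ A *ᵥ v) / (e ⬝ᵥ A *ᵥ e))) • e) ≠ 0) :
    (e ⬝ᵥ A *ᵥ e) * (v ⬝ᵥ A *ᵥ v) < (e ⬝ᵥ A *ᵥ v) ^ 2 := by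
  refine lt_of_le_of_ne (h.mul_le_sq hA he v) fun heq => hv (h.mulVec_eq_zero hA he ?_ ?_)
  · rw [mulVec_add, mulVec_smul, dotProduct_add, dotProduct_smul, smul_eq_mul]
    field_simp
    ring
  · rw [hA.quadratic_add_smul, hA.dotProduct_mulVec_comm v e]
    set p := e ⬝ᵥ A *ᵥ e
    field_simp
    linarith

theorem hyperbolicAt_zero (e : ι → ℝ) : (0 : Matrix ι ι ℝ).HyperbolicAt e := by
  intro v _; simp

/-- The range of a symmetric matrix is the orthogonal complement of its kernel. -/
theorem IsSymm.exists_mulVec_eq [DecidableEq ι] {A : Matrix ι ι ℝ} (hA : A.IsSymm) {b : ι → ℝ}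
    (hb : ∀ u, A *ᵥ u = 0 → u ⬝ᵥ b = 0) : ∃ v, A *ᵥ v = b := by
  have hT : A.toEuclideanLin.IsSymmetric := by
    rw [isSymmetric_toEuclideanLin_iff]
    exact hA
  have hmem : WithLp.toLp 2 b ∈ LinearMap.range A.toEuclideanLin := by
    rw [← Submodule.orthogonal_orthogonal (LinearMap.range A.toEuclideanLin),
      hT.orthogonal_range, Submodule.mem_orthogonal]
    intro u hu
    rw [LinearMap.mem_ker] at hu
    have h0 : A *ᵥ u.ofLp = 0 := by
      simpa [Matrix.toLpLin_apply] using congrArg WithLp.ofLp hu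
    have := hb _ h0
    rw [EuclideanSpace.inner_eq_star_dotProduct, star_trivial, dotProduct_comm]
    exact this
  obtain ⟨v, hv⟩ := hmem
  exact ⟨v.ofLp, by simpa [Matrix.toLpLin_apply] using congrArg WithLp.ofLp hv⟩

/-- The linear algebra of the trickle-down argument. Let `A` be a symmetric nonnegative matrix
supported on a connected graph on `N`, with row sums `c * h`. For `D = diag h` the matrix
`D^{-1/2} A D^{-1/2}` has top eigenvalue `c`, which is simple by a Perron–Frobenius argument, and
`hgap` excludes all other positive eigenvalues. -/
theorem IsSymm.hyperbolicAt_one_of_gap [DecidableEq ι] {A : Matrix ι ι ℝ} (hA : A.IsSymm)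
    {N : Finset ι} {h : ι → ℝ} {c : ℝ} (hnn : ∀ i j, 0 ≤ A i j)
    (hpos : ∀ i ∈ N, 0 < h i) (hrow : ∀ i ∈ N, (A *ᵥ 1) i = c * h i)
    (hzero : ∀ i ∉ N, ∀ j, A i j = 0)
    (hgap : ∀ v, c * (v ⬝ᵥ A *ᵥ v) ≤ ∑ i ∈ N, (A *ᵥ v) i ^ 2 / h i)
    (hconn : ∀ u : ι → ℝ, (∀ i j, A i j ≠ 0 → u i = u j) → ∀ i ∈ N, ∀ j ∈ N, u i = u j) :
    A.HyperbolicAt 1 := by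
  intro v hv
  set p : ι → ℝ := fun i => if i ∈ N then √(h i) else 1 with hp
  have hp0 : ∀ i, 0 < p i := by
    intro i
    by_cases hi : i ∈ N
    · simp [hp, hi, hpos i hi]
    · simp [hp, hi]
  have hpN : ∀ i ∈ N, p i * p i = h i := by
    intro i hi
    simp only [hp, hi, if_true]
    exact Real.mul_self_sqrt (hpos i hi).le
  have hAz : ∀ (u : ι → ℝ) i, i ∉ N → (A *ᵥ u) i = 0 := by
    intro u i hi
    simp [mulVec, dotProduct, hzero i hi]
  set B : Matrix ι ι ℝ := of fun i j => A i j / (p i * p j) with hB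
  have hBs : B.IsSymm := by
    ext i j
    simp only [hB, transpose_apply, of_apply, hA.apply, mul_comm]
  have hT : B.toEuclideanLin.IsSymmetric := by
    rw [isSymmetric_toEuclideanLin_iff]
    exact hBs
  have hTapp : ∀ x i, (B.toEuclideanLin x).ofLp i = (A *ᵥ fun j => x j / p j) i / p i := by
    intro x i
    simp only [toLpLin_apply, mulVec, dotProduct, hB, of_apply, Finset.sum_div]
    refine Finset.sum_congr rfl fun j _ => ?_
    have := (hp0 i).ne'
    have := (hp0 j).ne'
    field_simp
  have hTx : ∀ x, inner ℝ (B.toEuclideanLin x) x =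
      (fun j => x j / p j) ⬝ᵥ A *ᵥ (fun j => x j / p j) := by
    intro x
    rw [EuclideanSpace.inner_eq_star_dotProduct, star_trivial]
    simp only [dotProduct, hTapp]
    refine Finset.sum_congr rfl fun j _ => ?_
    have := (hp0 j).ne'
    field_simp
  set e : EuclideanSpace ℝ ι := WithLp.toLp 2 fun i => if i ∈ N then p i else 0 with he
  set x : EuclideanSpace ℝ ι := WithLp.toLp 2 fun i => p i * v i with hx
  have hxv : (fun j => x j / p j) = v := by
    ext j
    have := (hp0 j).ne'
    simp only [hx]
    field_simp
  have hone : (1 : ι → ℝ) ⬝ᵥ A *ᵥ v = c * ∑ i ∈ N, h i * v i := by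
    rw [hA.dotProduct_mulVec_comm, dotProduct, Finset.mul_sum,
      ← Finset.sum_subset (Finset.subset_univ N)]
    · refine Finset.sum_congr rfl fun i hi => ?_
      rw [hrow i hi]; ring
    · intro i _ hi
      rw [hAz _ i hi, mul_zero]
  -- `B = D^{-1/2} A D^{-1/2}`, `x = D^{1/2} v`, and the top eigenvector of `B` is `e = D^{1/2} 1`
  have hquad : v ⬝ᵥ A *ᵥ v = inner ℝ (B.toEuclideanLin x) x := by rw [hTx, hxv]
  by_cases hc : c = 0
  · have hA1 : ∀ i j, A i j = 0 := by
      intro i j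
      by_cases hi : i ∈ N
      · have h1 := hrow i hi
        rw [hc, zero_mul] at h1
        simp only [mulVec, dotProduct, Pi.one_apply, mul_one] at h1
        exact (Finset.sum_eq_zero_iff_of_nonneg fun j _ => hnn i j).1 h1 j (Finset.mem_univ j)
      · exact hzero i hi j
    have : A = 0 := by ext i j; exact hA1 i j
    simp [this]
  have hex : inner ℝ e x = 0 := by
    have h1 : ∑ i ∈ N, h i * v i = 0 := by
      rw [hone] at hv
      exact (mul_eq_zero.1 hv).resolve_left hc
    rw [EuclideanSpace.inner_eq_star_dotProduct, star_trivial, ← h1, dotProduct,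
      ← Finset.sum_subset (Finset.subset_univ N)]
    · refine Finset.sum_congr rfl fun i hi => ?_
      simp only [he, hx, hi, if_true, ← hpN i hi]
      ring
    · intro i _ hi
      simp [he, hi]
  rw [hquad]
  refine hT.inner_nonpos_of_eigenvalue_gap (c := c) (e := e) ?_ ?_ hex
  · intro y
    rw [hTx]
    refine (hgap _).trans (le_of_eq ?_)
    rw [EuclideanSpace.inner_eq_star_dotProduct, star_trivial, dotProduct,
      ← Finset.sum_subset (Finset.subset_univ N)]
    · refine Finset.sum_congr rfl fun i hi => ?_
      rw [hTapp, ← hpN i hi]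
      have := (hp0 i).ne'
      field_simp
    · intro i _ hi
      rw [hTapp, hAz _ i hi]
      simp
  · intro y μ hμ hcμ hy
    set u : ι → ℝ := fun j => y j / p j with hu
    have hAu : ∀ i, (A *ᵥ u) i = μ * (p i * p i) * u i := by
      intro i
      have h1 := hTapp y i
      rw [hy] at h1
      have := (hp0 i).ne'
      simp only [PiLp.smul_apply, smul_eq_mul] at h1
      rw [eq_div_iff this] at h1
      rw [← h1]
      simp only [hu]
      field_simp
    have huz : ∀ i ∉ N, u i = 0 := by
      intro i hi
      have h1 := hAu i
      rw [hAz _ i hi] at h1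
      have : μ * (p i * p i) ≠ 0 := by
        have := hp0 i
        positivity
      exact (mul_eq_zero.1 h1.symm).resolve_left this
    have hq1 : u ⬝ᵥ A *ᵥ u = μ * ∑ i ∈ N, h i * u i ^ 2 := by
      rw [dotProduct, Finset.mul_sum, ← Finset.sum_subset (Finset.subset_univ N)]
      · refine Finset.sum_congr rfl fun i hi => ?_
        rw [hAu, ← hpN i hi]; ring
      · intro i _ hi
        rw [huz i hi, zero_mul]
    have hq2 : ∑ i, u i ^ 2 * (A *ᵥ 1) i = c * ∑ i ∈ N, h i * u i ^ 2 := by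
      rw [Finset.mul_sum, ← Finset.sum_subset (Finset.subset_univ N)]
      · refine Finset.sum_congr rfl fun i hi => ?_
        rw [hrow i hi]; ring
      · intro i _ hi
        rw [hAz _ i hi, mul_zero]
    have hS : 0 ≤ ∑ i ∈ N, h i * u i ^ 2 :=
      Finset.sum_nonneg fun i hi => mul_nonneg (hpos i hi).le (sq_nonneg _)
    -- an eigenvalue `μ ≥ c` makes the Dirichlet form of `u` nonpositive, so that `u` is constant
    -- along the edges
    have e1 : ∑ i, ∑ j, A i j * u i ^ 2 = ∑ i, u i ^ 2 * (A *ᵥ 1) i := by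
      refine Finset.sum_congr rfl fun i _ => ?_
      simp only [mulVec, dotProduct, Pi.one_apply, mul_one, Finset.mul_sum]
      exact Finset.sum_congr rfl fun j _ => mul_comm _ _
    have e2 : ∑ i, ∑ j, A i j * u j ^ 2 = ∑ i, u i ^ 2 * (A *ᵥ 1) i := by
      rw [Finset.sum_comm, ← e1]
      refine Finset.sum_congr rfl fun i _ => Finset.sum_congr rfl fun j _ => ?_
      rw [hA.apply]
    have e3 : ∑ i, ∑ j, A i j * (u i * u j) = u ⬝ᵥ A *ᵥ u := by
      simp only [mulVec, dotProduct, Finset.mul_sum]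
      exact Finset.sum_congr rfl fun i _ => Finset.sum_congr rfl fun j _ => by ring
    have hdir : ∑ i, ∑ j, A i j * (u i - u j) ^ 2 ≤ 0 := by
      have h1 : ∑ i, ∑ j, A i j * (u i - u j) ^ 2 =
          ∑ i, ∑ j, A i j * u i ^ 2 + ∑ i, ∑ j, A i j * u j ^ 2
            - 2 * ∑ i, ∑ j, A i j * (u i * u j) := by
        simp only [Finset.mul_sum, ← Finset.sum_add_distrib, ← Finset.sum_sub_distrib]
        exact Finset.sum_congr rfl fun i _ => Finset.sum_congr rfl fun j _ => by ring
      rw [h1, e1, e2, e3, hq1, hq2]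
      nlinarith
    have hterm : ∀ i j, 0 ≤ A i j * (u i - u j) ^ 2 := fun i j =>
      mul_nonneg (hnn i j) (sq_nonneg _)
    have hzero2 : ∀ i j, A i j * (u i - u j) ^ 2 = 0 := by
      have h0 := le_antisymm hdir
        (Finset.sum_nonneg fun i _ => Finset.sum_nonneg fun j _ => hterm i j)
      intro i j
      have h1 := (Finset.sum_eq_zero_iff_of_nonneg
        fun i _ => Finset.sum_nonneg fun j _ => hterm i j).1 h0 i (Finset.mem_univ i)
      exact (Finset.sum_eq_zero_iff_of_nonneg fun j _ => hterm i j).1 h1 j (Finset.mem_univ j)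
    have hconst := hconn u fun i j hij => by
      have := (mul_eq_zero.1 (hzero2 i j)).resolve_left hij
      have := pow_eq_zero_iff (two_ne_zero) |>.1 this
      linarith
    obtain ⟨t, ht⟩ : ∃ t, ∀ i ∈ N, u i = t := by
      rcases N.eq_empty_or_nonempty with hN | ⟨i₀, hi₀⟩
      · exact ⟨0, by simp [hN]⟩
      · exact ⟨u i₀, fun i hi => hconst i hi i₀ hi₀⟩
    refine ⟨t, ?_⟩
    ext i
    have hyi : y i = u i * p i := by
      have := (hp0 i).ne'
      simp only [hu]
      field_simp
    rw [hyi]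
    by_cases hi : i ∈ N
    · simp [he, hi, ht i hi]
    · simp [he, hi, huz i hi]

end Matrix

/-! ### Weighted counts of independent sets -/

namespace Matroid

theorem Indep.exists_superset_card_eq {α : Type*} [Finite α] {M : Matroid α} {S : Finset α}
    (hS : M.Indep (S : Set α)) {d : ℕ}
    (hd : S.card ≤ d) (hr : (d : ℕ∞) ≤ M.eRank) :
    ∃ I : Finset α, S ⊆ I ∧ M.Indep (I : Set α) ∧ I.card = d := by
  obtain ⟨B, hB, hSB⟩ := hS.exists_isBase_superset
  lift B to Finset α using B.toFinite
  have hc : d ≤ B.card := by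
    rw [← hB.encard_eq_eRank, Set.encard_coe_eq_coe_finsetCard] at hr
    exact_mod_cast hr
  obtain ⟨I, h1, h2, h3⟩ := Finset.exists_subsuperset_card_eq (Finset.coe_subset.1 hSB) hd hc
  exact ⟨I, h1, hB.indep.subset (Finset.coe_subset.2 h2), h3⟩

variable {α : Type*} [Fintype α] [DecidableEq α] (M : Matroid α) (a : α → ℝ)

open Classical in
/-- The weighted count `∑ ∏ i ∈ I, a i` of the independent sets `I` of size `d` that contain `S`.
For independent `S` this is `∏ i ∈ S, a i` times the iterated derivative along
`S`, at the point `a`, of the generating polynomial of the independent sets of size `d`. -/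
noncomputable def indepSum (d : ℕ) (S : Finset α) : ℝ :=
  ∑ I ∈ Finset.univ.filter (fun I : Finset α => M.Indep (I : Set α) ∧ I.card = d ∧ S ⊆ I),
    ∏ i ∈ I, a i

/-- The weighted degree of `i` in the link of `S`: the gradient of the generating polynomial after
differentiating along `S`, in the coordinates scaled so that the base point is `1`. -/
noncomputable def linkDeg (d : ℕ) (S : Finset α) (i : α) : ℝ :=
  if i ∈ S then 0 else M.indepSum a d (insert i S)

/-- The weighted adjacency matrix of the link of `S`: the Hessian of the generating polynomial after
differentiating along `S`, in the coordinates scaled so that the base point is `1`. -/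
noncomputable def linkMatrix (d : ℕ) (S : Finset α) : Matrix α α ℝ :=
  Matrix.of fun i j => if i ∈ S then 0 else M.linkDeg a d (insert i S) j

open Classical in
/-- The elements extending `S` to a larger independent set. -/
noncomputable def linkVerts (S : Finset α) : Finset α :=
  Finset.univ.filter fun i => i ∉ S ∧ M.Indep (insert i S : Finset α)

variable {M a}

theorem mem_linkVerts {S : Finset α} {i : α} :
    i ∈ M.linkVerts S ↔ i ∉ S ∧ M.Indep (insert i S : Finset α) := by
  simp [linkVerts]

theorem indepSum_nonneg (ha : ∀ i, 0 < a i) (d : ℕ) (S : Finset α) : 0 ≤ M.indepSum a d S :=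
  Finset.sum_nonneg fun _ _ => Finset.prod_nonneg fun i _ => (ha i).le

theorem indepSum_eq_zero {S : Finset α} (hS : ¬ M.Indep (S : Set α)) (d : ℕ) :
    M.indepSum a d S = 0 := by
  refine Finset.sum_eq_zero fun I hI => ?_
  simp only [Finset.mem_filter] at hI
  exact absurd (hI.2.1.subset (Finset.coe_subset.2 hI.2.2.2)) hS

theorem indepSum_of_card_eq {S : Finset α} {d : ℕ} (hS : S.card = d)
    (hi : M.Indep (S : Set α)) : M.indepSum a d S = ∏ i ∈ S, a i := by
  classical
  rw [indepSum, Finset.sum_eq_single_of_mem S]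
  · simp [hS, hi]
  · intro I hI hne
    simp only [Finset.mem_filter] at hI
    exact absurd (Finset.eq_of_subset_of_card_le hI.2.2.2 (by omega)).symm hne

theorem indepSum_pos (ha : ∀ i, 0 < a i) {S : Finset α} (hS : M.Indep (S : Set α)) {d : ℕ}
    (hd : S.card ≤ d) (hr : (d : ℕ∞) ≤ M.eRank) : 0 < M.indepSum a d S := by
  classical
  obtain ⟨I, h1, h2, h3⟩ := hS.exists_superset_card_eq hd hr
  refine Finset.sum_pos (fun _ _ => Finset.prod_pos fun i _ => ha i) ⟨I, ?_⟩
  simp [h1, h2, h3]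

theorem linkDeg_nonneg (ha : ∀ i, 0 < a i) (d : ℕ) (S : Finset α) (i : α) :
    0 ≤ M.linkDeg a d S i := by
  unfold linkDeg
  split_ifs
  exacts [le_rfl, indepSum_nonneg ha _ _]

theorem linkMatrix_nonneg (ha : ∀ i, 0 < a i) (d : ℕ) (S : Finset α) (i j : α) :
    0 ≤ M.linkMatrix a d S i j := by
  simp only [linkMatrix, Matrix.of_apply]
  split_ifs
  exacts [le_rfl, linkDeg_nonneg ha _ _ _]

theorem linkDeg_of_mem {S : Finset α} {i : α} (hi : i ∈ S) (d : ℕ) : M.linkDeg a d S i = 0 :=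
  if_pos hi

theorem linkDeg_eq_zero {S : Finset α} {i : α} (hi : i ∉ M.linkVerts S) (d : ℕ) :
    M.linkDeg a d S i = 0 := by
  unfold linkDeg
  split_ifs with h
  · rfl
  · exact indepSum_eq_zero (fun h' => hi (mem_linkVerts.2 ⟨h, h'⟩)) d

theorem linkDeg_pos (ha : ∀ i, 0 < a i) {S : Finset α} {i : α} (hi : i ∈ M.linkVerts S) {d : ℕ}
    (hd : S.card + 1 ≤ d) (hr : (d : ℕ∞) ≤ M.eRank) : 0 < M.linkDeg a d S i := by
  obtain ⟨h1, h2⟩ := mem_linkVerts.1 hi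
  rw [linkDeg, if_neg h1]
  exact indepSum_pos ha h2 (by rwa [Finset.card_insert_of_notMem h1]) hr

theorem linkMatrix_apply_of_notMem {S : Finset α} {i : α} (hi : i ∉ S) (d : ℕ) (j : α) :
    M.linkMatrix a d S i j = M.linkDeg a d (insert i S) j := by
  simp [linkMatrix, hi]

theorem linkMatrix_apply (d : ℕ) (S : Finset α) (i j : α) :
    M.linkMatrix a d S i j =
      if i ∈ S ∨ j ∈ S ∨ i = j then 0 else M.indepSum a d (insert i (insert j S)) := by
  simp only [linkMatrix, linkDeg, Matrix.of_apply, Finset.mem_insert]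
  by_cases h1 : i ∈ S <;> by_cases h2 : j ∈ S <;> by_cases h3 : i = j <;>
    simp [h1, h2, h3, Finset.insert_comm, eq_comm]

theorem linkMatrix_isSymm (d : ℕ) (S : Finset α) : (M.linkMatrix a d S).IsSymm := by
  ext i j
  rw [Matrix.transpose_apply, linkMatrix_apply, linkMatrix_apply, Finset.insert_comm]
  congr 1
  simp only [eq_iff_iff]
  constructor <;> rintro (h | h | h) <;> simp [h]

theorem linkMatrix_eq_zero_of_not_indep {S : Finset α} (hS : ¬ M.Indep (S : Set α)) (d : ℕ) :
    M.linkMatrix a d S = 0 := by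
  ext i j
  rw [linkMatrix_apply, Matrix.zero_apply]
  split_ifs
  · rfl
  · refine indepSum_eq_zero (fun h => hS (h.subset ?_)) d
    intro x hx
    simp only [Finset.coe_insert, Set.mem_insert_iff]
    exact Or.inr (Or.inr hx)

theorem linkMatrix_eq_zero_of_notMem_linkVerts {S : Finset α} {i : α} (hi : i ∉ M.linkVerts S)
    (d : ℕ) (j : α) : M.linkMatrix a d S i j = 0 := by
  rw [linkMatrix_apply]
  split_ifs with h
  · rfl
  · push Not at h
    refine indepSum_eq_zero (fun h' => hi (mem_linkVerts.2 ⟨h.1, h'.subset ?_⟩)) d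
    intro x hx
    simp only [Finset.coe_insert, Set.mem_insert_iff] at hx ⊢
    tauto

/-- Euler's identity, by double counting: an independent set `I ⊇ S` of size `d` is counted once
for each element of `I \ S`. -/
theorem sum_linkDeg (d : ℕ) (S : Finset α) :
    ∑ i, M.linkDeg a d S i = (d - S.card : ℝ) * M.indepSum a d S := by
  classical
  have h1 : ∀ i, M.linkDeg a d S i =
      ∑ I ∈ Finset.univ.filter (fun I : Finset α => M.Indep (I : Set α) ∧ I.card = d ∧ S ⊆ I),
        if i ∈ I \ S then ∏ l ∈ I, a l else 0 := by
    intro i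
    unfold linkDeg
    split_ifs with h
    · simp [h]
    · rw [indepSum, ← Finset.sum_filter, Finset.filter_filter]
      refine Finset.sum_congr ?_ fun _ _ => rfl
      ext I
      simp only [Finset.mem_filter, Finset.mem_univ, true_and, Finset.insert_subset_iff,
        Finset.mem_sdiff, h, not_false_eq_true, and_true]
      tauto
  simp_rw [h1]
  rw [Finset.sum_comm, indepSum, Finset.mul_sum]
  refine Finset.sum_congr rfl fun I hI => ?_
  simp only [Finset.mem_filter] at hI
  rw [← Finset.sum_filter, Finset.sum_const, nsmul_eq_mul]
  congr 1
  rw [Finset.filter_mem_eq_inter, Finset.univ_inter, Finset.card_sdiff_of_subset hI.2.2.2,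
    Nat.cast_sub (Finset.card_le_card hI.2.2.2), hI.2.2.1]

theorem linkMatrix_mulVec_one (d : ℕ) (S : Finset α) (i : α) :
    (M.linkMatrix a d S *ᵥ 1) i = (d - S.card - 1 : ℝ) * M.linkDeg a d S i := by
  simp only [Matrix.mulVec, dotProduct, Pi.one_apply, mul_one]
  by_cases hi : i ∈ S
  · simp [linkMatrix, linkDeg, hi]
  · simp_rw [linkMatrix_apply_of_notMem hi]
    rw [sum_linkDeg, Finset.card_insert_of_notMem hi, linkDeg, if_neg hi]
    push_cast
    ring

theorem linkDeg_insert_dotProduct {S : Finset α} {l : α} (hl : l ∉ S) (d : ℕ) (v : α → ℝ) :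
    M.linkDeg a d (insert l S) ⬝ᵥ v = (M.linkMatrix a d S *ᵥ v) l := by
  simp only [Matrix.mulVec, dotProduct, linkMatrix_apply_of_notMem hl]

theorem one_dotProduct_linkMatrix_mulVec (d : ℕ) (S : Finset α) (v : α → ℝ) :
    1 ⬝ᵥ M.linkMatrix a d S *ᵥ v = (d - S.card - 1 : ℝ) * (M.linkDeg a d S ⬝ᵥ v) := by
  rw [(linkMatrix_isSymm d S).dotProduct_mulVec_comm, dotProduct, dotProduct, Finset.mul_sum]
  exact Finset.sum_congr rfl fun i _ => by rw [linkMatrix_mulVec_one]; ring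

theorem one_dotProduct_linkMatrix_mulVec_one (d : ℕ) (S : Finset α) :
    1 ⬝ᵥ M.linkMatrix a d S *ᵥ 1 =
      (d - S.card - 1 : ℝ) * ((d - S.card) * M.indepSum a d S) := by
  rw [one_dotProduct_linkMatrix_mulVec, dotProduct_one, sum_linkDeg]

theorem sum_compl_indepSum (d : ℕ) (S : Finset α) :
    ∑ l ∈ Sᶜ, M.indepSum a d (insert l S) = (d - S.card : ℝ) * M.indepSum a d S := by
  rw [← sum_linkDeg, ← Finset.sum_subset (Finset.subset_univ Sᶜ)]
  · refine Finset.sum_congr rfl fun l hl => ?_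
    rw [linkDeg, if_neg (Finset.mem_compl.1 hl)]
  · intro l _ hl
    exact linkDeg_of_mem (by simpa using hl) d

theorem sum_compl_linkDeg (d : ℕ) (S : Finset α) (i : α) :
    ∑ l ∈ Sᶜ, M.linkDeg a d (insert l S) i = (d - S.card - 1 : ℝ) * M.linkDeg a d S i := by
  rw [← linkMatrix_mulVec_one, Matrix.mulVec, dotProduct,
    ← Finset.sum_subset (Finset.subset_univ Sᶜ)]
  · refine Finset.sum_congr rfl fun l hl => ?_
    rw [← (linkMatrix_isSymm d S).apply, linkMatrix_apply_of_notMem (Finset.mem_compl.1 hl)]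
    simp
  · intro l _ hl
    have : l ∈ S := by simpa using hl
    simp [linkMatrix_apply, this]

theorem sum_compl_linkMatrix (d : ℕ) (S : Finset α) :
    ∑ l ∈ Sᶜ, M.linkMatrix a d (insert l S) = (d - S.card - 2 : ℝ) • M.linkMatrix a d S := by
  ext i j
  rw [Matrix.sum_apply, Matrix.smul_apply, smul_eq_mul]
  by_cases hi : i ∈ S
  · simp [linkMatrix_apply, hi]
  have h1 : ∀ l ∈ Sᶜ, M.linkMatrix a d (insert l S) i j =
      if i = l then 0 else M.linkDeg a d (insert l (insert i S)) j := by
    intro l _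
    by_cases h : i = l
    · simp [linkMatrix_apply, h]
    · rw [linkMatrix_apply_of_notMem (by simp [h, hi]), if_neg h, Finset.insert_comm]
  rw [Finset.sum_congr rfl h1, linkMatrix_apply_of_notMem hi]
  have h2 : (d - S.card - 2 : ℝ) = d - (insert i S).card - 1 := by
    rw [Finset.card_insert_of_notMem hi]; push_cast; ring
  rw [h2, ← sum_compl_linkDeg, Finset.compl_insert, ← Finset.add_sum_erase Sᶜ _
    (Finset.mem_compl.2 hi), if_pos rfl, zero_add]
  refine Finset.sum_congr rfl fun l hl => ?_
  rw [if_neg (Finset.ne_of_mem_erase hl).symm]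

/-- Two elements of the link of `S` are adjacent exactly when they span different flats
with `S`. -/
theorem indep_insert_insert_iff {S : Finset α} {i j : α} (hi : i ∈ M.linkVerts S)
    (hj : j ∈ M.linkVerts S) :
    (i ≠ j ∧ M.Indep (insert i (insert j S) : Finset α)) ↔
      M.closure (insert i S : Finset α) ≠ M.closure (insert j S : Finset α) := by
  obtain ⟨hiS, hiI⟩ := mem_linkVerts.1 hi
  obtain ⟨hjS, hjI⟩ := mem_linkVerts.1 hj
  push_cast at *
  constructor
  · rintro ⟨hne, hI⟩ heq
    have h1 : i ∈ M.closure (insert j (S : Set α)) := by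
      rw [← heq]
      exact M.mem_closure_of_mem (Set.mem_insert _ _) hiI.subset_ground
    rw [hjI.insert_indep_iff_of_notMem (by simp [hne, hiS])] at hI
    exact hI.2 h1
  · intro hne
    have hne' : i ≠ j := by rintro rfl; exact hne rfl
    refine ⟨hne', ?_⟩
    rw [hjI.insert_indep_iff_of_notMem (by simp [hne', hiS])]
    refine ⟨hiI.subset_ground (Set.mem_insert _ _), fun hmem => hne ?_⟩
    refine M.closure_insert_congr ⟨hmem, ?_⟩
    rw [(hiI.subset (Set.subset_insert _ _)).insert_indep_iff_of_notMem (by simpa using hiS)] at hiI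
    exact hiI.2

theorem linkDeg_of_card_add_one {S : Finset α} {d : ℕ} (hd : S.card + 1 = d) {i : α}
    (hi : i ∈ M.linkVerts S) : M.linkDeg a d S i = (∏ l ∈ S, a l) * a i := by
  obtain ⟨h1, h2⟩ := mem_linkVerts.1 hi
  rw [linkDeg, if_neg h1, indepSum_of_card_eq (by rwa [Finset.card_insert_of_notMem h1]) h2,
    Finset.prod_insert h1, mul_comm]

open Classical in
theorem linkMatrix_of_card_add_two {S : Finset α} {d : ℕ} (hd : S.card + 2 = d) {i j : α}
    (hi : i ∈ M.linkVerts S) (hj : j ∈ M.linkVerts S) :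
    M.linkMatrix a d S i j =
      if M.closure (insert i S : Finset α) = M.closure (insert j S : Finset α) then 0
      else (∏ l ∈ S, a l) * (a i * a j) := by
  have h := indep_insert_insert_iff hi hj
  have hiS := (mem_linkVerts.1 hi).1
  have hjS := (mem_linkVerts.1 hj).1
  rw [linkMatrix_apply]
  by_cases heq : M.closure (insert i S : Finset α) = M.closure (insert j S : Finset α)
  · rw [if_pos heq]
    by_cases hij : i = j
    · simp [hij]
    · rw [if_neg (by simp [hiS, hjS, hij])]
      exact indepSum_eq_zero (fun hI => h.1 ⟨hij, hI⟩ heq) d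
  · obtain ⟨hij, hI⟩ := h.2 heq
    rw [if_neg heq, if_neg (by simp [hiS, hjS, hij])]
    have hi' : i ∉ insert j S := by simp [hij, hiS]
    rw [indepSum_of_card_eq _ hI, Finset.prod_insert hi', Finset.prod_insert hjS]
    · ring
    · rw [Finset.card_insert_of_notMem hi', Finset.card_insert_of_notMem hjS]; omega

end Matroid

/-! ### The link of an independent set of corank two -/

namespace Matroid

variable {α : Type*} [Fintype α] [DecidableEq α] {M : Matroid α} {a : α → ℝ}

open Classical in
variable (M) in
/-- The flats spanned by `S` and one further element; they index the parallel classes of the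
contraction of an independent set `S`. -/
noncomputable def linkFlats (S : Finset α) : Finset (Set α) :=
  (M.linkVerts S).image fun i => M.closure (insert i S : Finset α)

open Classical in
variable (M) in
/-- The sum of `x` over the parallel class that corresponds to the flat `F` over `S`. -/
noncomputable def classSum (S : Finset α) (x : α → ℝ) (F : Set α) : ℝ :=
  ∑ i ∈ (M.linkVerts S).filter fun i => M.closure (insert i S : Finset α) = F, x i

theorem closure_mem_linkFlats {S : Finset α} {i : α} (hi : i ∈ M.linkVerts S) :
    M.closure (insert i S : Finset α) ∈ M.linkFlats S := by
  classical exact Finset.mem_image_of_mem _ hi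

theorem exists_of_mem_linkFlats {S : Finset α} {F : Set α} (hF : F ∈ M.linkFlats S) :
    ∃ i ∈ M.linkVerts S, M.closure (insert i S : Finset α) = F := by
  classical simpa [linkFlats] using hF

theorem sum_linkVerts_mul (S : Finset α) (x : α → ℝ) (g : Set α → ℝ) :
    ∑ i ∈ M.linkVerts S, x i * g (M.closure (insert i S : Finset α)) =
      ∑ F ∈ M.linkFlats S, M.classSum S x F * g F := by
  classical
  rw [← Finset.sum_fiberwise_of_maps_to (t := M.linkFlats S)
    (g := fun i => M.closure (insert i S : Finset α)) fun i hi => closure_mem_linkFlats hi]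
  refine Finset.sum_congr rfl fun F _ => ?_
  rw [classSum, Finset.sum_mul]
  refine Finset.sum_congr rfl fun i hi => ?_
  rw [(Finset.mem_filter.1 hi).2]

theorem sum_linkVerts (S : Finset α) (x : α → ℝ) :
    ∑ i ∈ M.linkVerts S, x i = ∑ F ∈ M.linkFlats S, M.classSum S x F := by
  simpa using sum_linkVerts_mul (M := M) S x fun _ => 1

theorem linkMatrix_mulVec_of_card_add_two {S : Finset α} {d : ℕ} (hd : S.card + 2 = d) {i : α}
    (hi : i ∈ M.linkVerts S) (v : α → ℝ) :
    (M.linkMatrix a d S *ᵥ v) i = (∏ l ∈ S, a l) * a i *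
      (∑ j ∈ M.linkVerts S, a j * v j -
        M.classSum S (fun j => a j * v j) (M.closure (insert i S : Finset α))) := by
  classical
  rw [Matrix.mulVec, dotProduct, ← Finset.sum_subset (Finset.subset_univ (M.linkVerts S))]
  · rw [classSum, Finset.sum_filter, ← Finset.sum_sub_distrib, Finset.mul_sum]
    refine Finset.sum_congr rfl fun j hj => ?_
    rw [linkMatrix_of_card_add_two hd hi hj]
    by_cases h : M.closure (insert i S : Finset α) = M.closure (insert j S : Finset α)
    · rw [if_pos h, if_pos h.symm]; ring
    · rw [if_neg h, if_neg (Ne.symm h)]; ring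
  · intro j _ hj
    rw [← (linkMatrix_isSymm d S).apply, linkMatrix_eq_zero_of_notMem_linkVerts hj, zero_mul]

theorem dotProduct_linkMatrix_mulVec_of_card_add_two {S : Finset α} {d : ℕ}
    (hd : S.card + 2 = d) (u v : α → ℝ) :
    u ⬝ᵥ M.linkMatrix a d S *ᵥ v = (∏ l ∈ S, a l) *
      ((∑ j ∈ M.linkVerts S, a j * u j) * (∑ j ∈ M.linkVerts S, a j * v j) -
        ∑ F ∈ M.linkFlats S,
          M.classSum S (fun j => a j * u j) F * M.classSum S (fun j => a j * v j) F) := by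
  rw [dotProduct, ← Finset.sum_subset (Finset.subset_univ (M.linkVerts S)),
    ← sum_linkVerts_mul, Finset.sum_mul, ← Finset.sum_sub_distrib, Finset.mul_sum]
  · refine Finset.sum_congr rfl fun i hi => ?_
    rw [linkMatrix_mulVec_of_card_add_two hd hi]
    ring
  · intro j _ hj
    rw [Matrix.mulVec, dotProduct, Finset.sum_eq_zero, mul_zero]
    intro l _
    rw [linkMatrix_eq_zero_of_notMem_linkVerts hj, zero_mul]

theorem Indep.exists_mem_linkVerts {S : Finset α} (hS : M.Indep (S : Set α))
    (hr : ((S.card + 1 : ℕ) : ℕ∞) ≤ M.eRank) : ∃ i, i ∈ M.linkVerts S := by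
  obtain ⟨I, h1, h2, h3⟩ := hS.exists_superset_card_eq (Nat.le_succ _) hr
  obtain ⟨i, hi, rfl⟩ := Finset.exists_eq_insert_iff.2 ⟨h1, h3.symm⟩
  exact ⟨i, mem_linkVerts.2 ⟨hi, h2⟩⟩

theorem exists_closure_ne {S : Finset α} (hr : ((S.card + 2 : ℕ) : ℕ∞) ≤ M.eRank)
    {i : α} (hi : i ∈ M.linkVerts S) : ∃ l ∈ M.linkVerts S,
      M.closure (insert l S : Finset α) ≠ M.closure (insert i S : Finset α) := by
  obtain ⟨hiS, hiI⟩ := mem_linkVerts.1 hi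
  obtain ⟨l, hl⟩ := hiI.exists_mem_linkVerts (by rwa [Finset.card_insert_of_notMem hiS])
  obtain ⟨h1, h2⟩ := mem_linkVerts.1 hl
  have hlN : l ∈ M.linkVerts S := by
    refine mem_linkVerts.2 ⟨fun h => h1 (Finset.mem_insert_of_mem h), h2.subset ?_⟩
    exact Finset.coe_subset.2 (Finset.insert_subset_insert _ (Finset.subset_insert _ _))
  refine ⟨l, hlN, (indep_insert_insert_iff hlN hi).1 ⟨?_, h2⟩⟩
  rintro rfl
  exact h1 (Finset.mem_insert_self _ _)

theorem one_lt_card_linkFlats {S : Finset α} (hS : M.Indep (S : Set α))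
    (hr : ((S.card + 2 : ℕ) : ℕ∞) ≤ M.eRank) : 1 < (M.linkFlats S).card := by
  obtain ⟨i, hi⟩ := hS.exists_mem_linkVerts (le_trans (by norm_cast; omega) hr)
  obtain ⟨l, hl, hne⟩ := exists_closure_ne hr hi
  exact Finset.one_lt_card.2 ⟨_, closure_mem_linkFlats hl, _, closure_mem_linkFlats hi, hne⟩

/-- The Hessian of a complete multipartite quadric: Cauchy–Schwarz over the parallel classes. -/
theorem hyperbolicAt_linkMatrix_of_card_add_two (ha : ∀ i, 0 < a i) {S : Finset α} {d : ℕ}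
    (hd : S.card + 2 = d) : (M.linkMatrix a d S).HyperbolicAt 1 := by
  intro v hv
  rw [dotProduct_linkMatrix_mulVec_of_card_add_two hd] at hv ⊢
  have hP : 0 < ∏ l ∈ S, a l := Finset.prod_pos fun i _ => ha i
  set x : α → ℝ := fun j => a j * v j
  set b : α → ℝ := fun j => a j * (1 : α → ℝ) j with hb
  have hb0 : ∀ j, 0 < b j := fun j => by simpa [hb] using ha j
  have hbF : ∀ F, 0 ≤ M.classSum S b F := fun F => Finset.sum_nonneg fun i _ => (hb0 i).le
  set A := ∑ j ∈ M.linkVerts S, b j with hA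
  set T := ∑ j ∈ M.linkVerts S, x j with hT
  have h1 : A * T = ∑ F ∈ M.linkFlats S, M.classSum S b F * M.classSum S x F := by
    have := (mul_eq_zero.1 hv).resolve_left hP.ne'
    linarith
  have h2 := Finset.sum_mul_sq_le_sq_mul_sq (M.linkFlats S) (M.classSum S b) (M.classSum S x)
  rw [← h1] at h2
  have h3 : ∑ F ∈ M.linkFlats S, M.classSum S b F ^ 2 ≤ A ^ 2 := by
    rw [hA, sum_linkVerts]
    exact Finset.sum_sq_le_sq_sum_of_nonneg fun F _ => hbF F
  have hTT : 0 ≤ ∑ F ∈ M.linkFlats S, M.classSum S x F ^ 2 :=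
    Finset.sum_nonneg fun _ _ => sq_nonneg _
  refine mul_nonpos_of_nonneg_of_nonpos hP.le ?_
  simp_rw [← sq]
  rcases (M.linkVerts S).eq_empty_or_nonempty with h0 | hne
  · rw [hT, h0]
    simpa using hTT
  have hApos : 0 < A := Finset.sum_pos (fun j _ => hb0 j) hne
  have h4 : A ^ 2 * T ^ 2 ≤ A ^ 2 * ∑ F ∈ M.linkFlats S, M.classSum S x F ^ 2 := by
    rw [← mul_pow]
    exact h2.trans (mul_le_mul_of_nonneg_right h3 hTT)
  have := le_of_mul_le_mul_left h4 (by positivity)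
  linarith

theorem sum_linkVerts_eq_card_mul {S : Finset α} {x : α → ℝ} {c : ℝ}
    (h : ∀ i ∈ M.linkVerts S, M.classSum S x (M.closure (insert i S : Finset α)) = c) :
    ∑ i ∈ M.linkVerts S, x i = (M.linkFlats S).card * c := by
  rw [sum_linkVerts, Finset.sum_congr rfl (g := fun _ => c), Finset.sum_const, nsmul_eq_mul]
  intro F hF
  obtain ⟨i, hi, rfl⟩ := exists_of_mem_linkFlats hF
  exact h i hi

/-- In corank two the kernel of the Hessian consists of the vectors whose sum over each parallel
class, in the unscaled coordinates `a j * v j`, vanishes. -/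
theorem sum_linkVerts_eq_zero (ha : ∀ i, 0 < a i) {S : Finset α} {d : ℕ} (hd : S.card + 2 = d)
    (hS : M.Indep (S : Set α)) (hr : (d : ℕ∞) ≤ M.eRank) {v : α → ℝ}
    (hv : M.linkMatrix a d S *ᵥ v = 0) :
    ∑ i ∈ M.linkVerts S, a i * v i = 0 ∧ ∀ i ∈ M.linkVerts S,
      M.classSum S (fun j => a j * v j) (M.closure (insert i S : Finset α)) = 0 := by
  have h1 : ∀ i ∈ M.linkVerts S,
      M.classSum S (fun j => a j * v j) (M.closure (insert i S : Finset α)) =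
        ∑ i ∈ M.linkVerts S, a i * v i := by
    intro i hi
    have h := congrFun hv i
    rw [linkMatrix_mulVec_of_card_add_two hd hi, Pi.zero_apply] at h
    have hP : 0 < ∏ l ∈ S, a l := Finset.prod_pos fun i _ => ha i
    have := (mul_eq_zero.1 h).resolve_left (mul_pos hP (ha i)).ne'
    linarith
  have h2 := sum_linkVerts_eq_card_mul h1
  have hp : (1 : ℝ) < (M.linkFlats S).card := by
    exact_mod_cast one_lt_card_linkFlats hS (by rwa [hd])
  have h3 : ∑ i ∈ M.linkVerts S, a i * v i = 0 := by
    have : ((M.linkFlats S).card - 1 : ℝ) * ∑ i ∈ M.linkVerts S, a i * v i = 0 := by linarith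
    exact (mul_eq_zero.1 this).resolve_left (by linarith)
  exact ⟨h3, fun i hi => (h1 i hi).trans h3⟩

/-! ### The basis generating polynomial -/

/-- Hyperbolicity passes from the partial derivatives to the polynomial. By Euler's identity the
Hessian is an average of those of the partial derivatives, and the reversed Cauchy–Schwarz
inequality for the latter is the spectral gap needed in `Matrix.IsSymm.hyperbolicAt_one_of_gap`. -/
theorem hyperbolicAt_linkMatrix_of_insert (ha : ∀ i, 0 < a i) {S : Finset α} {d : ℕ}
    (hd : S.card + 3 ≤ d) (hr : (d : ℕ∞) ≤ M.eRank)
    (hyp : ∀ l ∉ S, (M.linkMatrix a d (insert l S)).HyperbolicAt 1) :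
    (M.linkMatrix a d S).HyperbolicAt 1 := by
  have hd' : (S.card : ℝ) + 3 ≤ d := by exact_mod_cast hd
  refine (linkMatrix_isSymm d S).hyperbolicAt_one_of_gap (N := M.linkVerts S)
    (h := M.linkDeg a d S) (c := d - S.card - 1) (linkMatrix_nonneg ha d S)
    (fun i hi => linkDeg_pos ha hi (by omega) hr) (fun i _ => linkMatrix_mulVec_one d S i)
    (fun i hi j => linkMatrix_eq_zero_of_notMem_linkVerts hi d j) ?_ ?_
  · intro v
    have hq : 0 < (d - S.card - 2 : ℝ) := by linarith
    have hterm : ∀ l ∈ M.linkVerts S,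
        (d - S.card - 1 : ℝ) * (v ⬝ᵥ M.linkMatrix a d (insert l S) *ᵥ v) ≤
          (d - S.card - 2) * ((M.linkMatrix a d S *ᵥ v) l ^ 2 / M.linkDeg a d S l) := by
      intro l hl
      have hlS := (mem_linkVerts.1 hl).1
      have hpos := linkDeg_pos ha hl (show S.card + 1 ≤ d by omega) hr
      have h11 : (1 : α → ℝ) ⬝ᵥ M.linkMatrix a d (insert l S) *ᵥ 1 =
          (d - S.card - 2 : ℝ) * ((d - S.card - 1) * M.linkDeg a d S l) := by
        rw [one_dotProduct_linkMatrix_mulVec_one, Finset.card_insert_of_notMem hlS, linkDeg,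
          if_neg hlS]
        push_cast; ring
      have h1v : (1 : α → ℝ) ⬝ᵥ M.linkMatrix a d (insert l S) *ᵥ v =
          (d - S.card - 2 : ℝ) * (M.linkMatrix a d S *ᵥ v) l := by
        rw [one_dotProduct_linkMatrix_mulVec, Finset.card_insert_of_notMem hlS,
          linkDeg_insert_dotProduct hlS]
        push_cast; ring
      have hpp : 0 < (1 : α → ℝ) ⬝ᵥ M.linkMatrix a d (insert l S) *ᵥ 1 := by
        rw [h11]
        have : 0 < (d - S.card - 1 : ℝ) := by linarith
        positivity
      have h := (hyp l hlS).mul_le_sq (linkMatrix_isSymm d _) hpp v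
      rw [h11, h1v] at h
      rw [mul_div_assoc', le_div_iff₀ hpos]
      refine le_of_mul_le_mul_left ?_ hq
      calc _ = _ := by ring
        _ ≤ _ := h
        _ = _ := by ring
    have hsum : (d - S.card - 2 : ℝ) * (v ⬝ᵥ M.linkMatrix a d S *ᵥ v) =
        ∑ l ∈ M.linkVerts S, v ⬝ᵥ M.linkMatrix a d (insert l S) *ᵥ v := by
      rw [← smul_eq_mul, ← dotProduct_smul, ← Matrix.smul_mulVec, ← sum_compl_linkMatrix,
        Matrix.sum_mulVec, dotProduct_sum]
      refine (Finset.sum_subset ?_ ?_).symm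
      · intro l hl
        exact Finset.mem_compl.2 (mem_linkVerts.1 hl).1
      · intro l hl hlN
        rw [linkMatrix_eq_zero_of_not_indep]
        · simp
        · exact fun h => hlN (mem_linkVerts.2 ⟨Finset.mem_compl.1 hl, h⟩)
    have h := Finset.sum_le_sum hterm
    rw [← Finset.mul_sum, ← hsum, ← Finset.mul_sum] at h
    refine le_of_mul_le_mul_left ?_ hq
    calc _ = _ := by ring
      _ ≤ _ := h
  · intro u hu i hi j hj
    have hadj : ∀ i ∈ M.linkVerts S, ∀ j ∈ M.linkVerts S,
        M.closure (insert i S : Finset α) ≠ M.closure (insert j S : Finset α) → u i = u j := by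
      intro i hi j hj hne
      obtain ⟨hij, hI⟩ := (indep_insert_insert_iff hi hj).2 hne
      have hiS := (mem_linkVerts.1 hi).1
      have hjS := (mem_linkVerts.1 hj).1
      refine hu i j ?_
      rw [linkMatrix_apply, if_neg (by simp [hiS, hjS, hij])]
      refine (indepSum_pos ha hI ?_ hr).ne'
      rw [Finset.card_insert_of_notMem (by simp [hij, hiS]), Finset.card_insert_of_notMem hjS]
      omega
    -- two parallel elements of the link have a common neighbour
    by_cases hne : M.closure (insert i S : Finset α) = M.closure (insert j S : Finset α)
    · obtain ⟨l, hl, hli⟩ := exists_closure_ne (le_trans (by norm_cast; omega) hr) hi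
      exact (hadj i hi l hl hli.symm).trans (hadj l hl j hj (hne ▸ hli))
    · exact hadj i hi j hj hne

/-- The Hessian of the basis generating polynomial of a truncation of `M`, and of all its iterated
derivatives, is hyperbolic at every positive point. -/
theorem hyperbolicAt_linkMatrix (ha : ∀ i, 0 < a i) {d : ℕ} (hr : (d : ℕ∞) ≤ M.eRank)
    {S : Finset α} (hd : S.card + 2 ≤ d) : (M.linkMatrix a d S).HyperbolicAt 1 := by
  obtain ⟨k, hk⟩ := Nat.exists_eq_add_of_le hd
  induction k generalizing S with
  | zero => exact hyperbolicAt_linkMatrix_of_card_add_two ha hk.symm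
  | succ k ih =>
    refine hyperbolicAt_linkMatrix_of_insert ha (by omega) hr fun l hl => ?_
    have := Finset.card_insert_of_notMem hl
    exact ih (by omega) (by omega)

theorem one_dotProduct_linkMatrix_mulVec_one_pos (ha : ∀ i, 0 < a i) {d : ℕ}
    (hr : (d : ℕ∞) ≤ M.eRank) {S : Finset α} (hd : S.card + 2 ≤ d) (hS : M.Indep (S : Set α)) :
    0 < (1 : α → ℝ) ⬝ᵥ M.linkMatrix a d S *ᵥ 1 := by
  rw [one_dotProduct_linkMatrix_mulVec_one]
  have h1 := indepSum_pos ha hS (show S.card ≤ d by omega) hr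
  have h2 : (S.card : ℝ) + 2 ≤ d := by exact_mod_cast hd
  exact mul_pos (by linarith) (mul_pos (by linarith) h1)

/-- The kernel of the Hessian is contained in the kernels of the Hessians of the partial
derivatives: each of these is nonpositive on the kernel, and they average to zero there. -/
theorem linkMatrix_insert_mulVec_eq_zero (ha : ∀ i, 0 < a i) {d : ℕ} (hr : (d : ℕ∞) ≤ M.eRank)
    {S : Finset α} (hd : S.card + 3 ≤ d) {v : α → ℝ} (hv : M.linkMatrix a d S *ᵥ v = 0)
    {l : α} (hl : l ∉ S) : M.linkMatrix a d (insert l S) *ᵥ v = 0 := by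
  by_cases hI : M.Indep (insert l S : Finset α)
  swap
  · simp [linkMatrix_eq_zero_of_not_indep hI]
  have h1v : ∀ i ∉ S, (1 : α → ℝ) ⬝ᵥ M.linkMatrix a d (insert i S) *ᵥ v = 0 := by
    intro i hi
    rw [one_dotProduct_linkMatrix_mulVec, linkDeg_insert_dotProduct hi, hv, Pi.zero_apply,
      mul_zero]
  have hcard : ∀ i ∉ S, (insert i S).card + 2 ≤ d := fun i hi => by
    rw [Finset.card_insert_of_notMem hi]; omega
  have hsum : ∑ i ∈ Sᶜ, v ⬝ᵥ M.linkMatrix a d (insert i S) *ᵥ v = 0 := by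
    rw [← dotProduct_sum, ← Matrix.sum_mulVec, sum_compl_linkMatrix, Matrix.smul_mulVec, hv]
    simp
  have hle : ∀ i ∈ Sᶜ, v ⬝ᵥ M.linkMatrix a d (insert i S) *ᵥ v ≤ 0 := fun i hi =>
    hyperbolicAt_linkMatrix ha hr (hcard i (Finset.mem_compl.1 hi)) v
      (h1v i (Finset.mem_compl.1 hi))
  have hz := (Finset.sum_eq_zero_iff_of_nonpos hle).1 hsum l (Finset.mem_compl.2 hl)
  exact (hyperbolicAt_linkMatrix ha hr (hcard l hl)).mulVec_eq_zero (linkMatrix_isSymm d _)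
    (one_dotProduct_linkMatrix_mulVec_one_pos ha hr (hcard l hl) hI) (h1v l hl) hz

theorem linkMatrix_mulVec_eq_zero_of_empty (ha : ∀ i, 0 < a i) {d : ℕ}
    (hr : (d : ℕ∞) ≤ M.eRank) {v : α → ℝ} (hv : M.linkMatrix a d ∅ *ᵥ v = 0) (S : Finset α)
    (hd : S.card + 2 ≤ d) : M.linkMatrix a d S *ᵥ v = 0 := by
  induction S using Finset.induction_on with
  | empty => exact hv
  | insert l S hl ih =>
    rw [Finset.card_insert_of_notMem hl] at hd
    exact linkMatrix_insert_mulVec_eq_zero ha hr (by omega) (ih (by omega)) hl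

end Matroid

/-! ### The Hessian bordered by the homogenizing variable -/

namespace Matroid

variable {α : Type*} [Fintype α] [DecidableEq α] {M : Matroid α} {a : α → ℝ}

variable (M a) in
/-- Up to a constant factor, the Hessian at `y = 0` of `∑ k, f_k y ^ (n - k)`, differentiated
`m = n - (e + 2)` times in `y` and along `S` in the other variables. The index `none` is the
variable `y`; the other coordinates are scaled so that the base point is `1`. -/
noncomputable def borderMatrix (m e : ℕ) (S : Finset α) : Matrix (Option α) (Option α) ℝ :=
  Matrix.of fun
    | none, none => (m + 2 : ℝ) * (m + 1) * M.indepSum a e S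
    | none, some i => (m + 1 : ℝ) * M.linkDeg a (e + 1) S i
    | some i, none => (m + 1 : ℝ) * M.linkDeg a (e + 1) S i
    | some i, some j => M.linkMatrix a (e + 2) S i j

variable (α) in
/-- The base point of the bordered Hessian: `1` in the old variables and `0` in the new one. -/
def basePoint : Option α → ℝ := fun o => o.elim 0 1

variable {m e : ℕ}

theorem borderMatrix_isSymm (S : Finset α) : (M.borderMatrix a m e S).IsSymm := by
  ext (_ | i) (_ | j) <;> simp [borderMatrix, (linkMatrix_isSymm (e + 2) S).apply]

theorem borderMatrix_mulVec_none (S : Finset α) (w : Option α → ℝ) :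
    (M.borderMatrix a m e S *ᵥ w) none = (m + 2 : ℝ) * (m + 1) * M.indepSum a e S * w none +
      (m + 1) * (M.linkDeg a (e + 1) S ⬝ᵥ fun i => w (some i)) := by
  simp [Matrix.mulVec, dotProduct, Fintype.sum_option, borderMatrix, Finset.mul_sum, mul_assoc]

theorem borderMatrix_mulVec_some (S : Finset α) (w : Option α → ℝ) (i : α) :
    (M.borderMatrix a m e S *ᵥ w) (some i) = (m + 1 : ℝ) * M.linkDeg a (e + 1) S i * w none +
      (M.linkMatrix a (e + 2) S *ᵥ fun i => w (some i)) i := by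
  simp [Matrix.mulVec, dotProduct, Fintype.sum_option, borderMatrix]

omit [DecidableEq α] in
theorem basePoint_dotProduct (u : Option α → ℝ) : basePoint α ⬝ᵥ u = ∑ i, u (some i) := by
  simp [basePoint, dotProduct, Fintype.sum_option]

theorem basePoint_dotProduct_borderMatrix_mulVec (S : Finset α) (w : Option α → ℝ) :
    basePoint α ⬝ᵥ M.borderMatrix a m e S *ᵥ w = (e + 1 - S.card : ℝ) *
      ((m + 1) * M.indepSum a (e + 1) S * w none +
        (M.linkDeg a (e + 2) S ⬝ᵥ fun i => w (some i))) := by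
  have h := one_dotProduct_linkMatrix_mulVec (M := M) (a := a) (e + 2) S fun i => w (some i)
  rw [one_dotProduct] at h
  simp_rw [basePoint_dotProduct, borderMatrix_mulVec_some]
  rw [Finset.sum_add_distrib, h, ← Finset.sum_mul, ← Finset.mul_sum, sum_linkDeg]
  push_cast
  ring

theorem basePoint_dotProduct_borderMatrix_mulVec_basePoint (S : Finset α) :
    basePoint α ⬝ᵥ M.borderMatrix a m e S *ᵥ basePoint α =
      1 ⬝ᵥ M.linkMatrix a (e + 2) S *ᵥ 1 := by
  rw [basePoint_dotProduct_borderMatrix_mulVec, one_dotProduct_linkMatrix_mulVec]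
  have : (fun i => basePoint α (some i)) = 1 := by ext; simp [basePoint]
  rw [this]
  simp [basePoint]
  left; ring

/-- Contracting a further element `l` turns the `l`-th row into the gradient. -/
theorem basePoint_dotProduct_borderMatrix_insert_mulVec {S : Finset α} {l : α} (hl : l ∉ S)
    (w : Option α → ℝ) :
    basePoint α ⬝ᵥ M.borderMatrix a m e (insert l S) *ᵥ w =
      (e - S.card : ℝ) * (M.borderMatrix a m e S *ᵥ w) (some l) := by
  rw [basePoint_dotProduct_borderMatrix_mulVec, Finset.card_insert_of_notMem hl,
    linkDeg_insert_dotProduct hl, borderMatrix_mulVec_some, linkDeg, if_neg hl]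
  push_cast
  ring

theorem sum_compl_borderMatrix (S : Finset α) :
    ∑ l ∈ Sᶜ, M.borderMatrix a m e (insert l S) =
      (e - S.card : ℝ) • M.borderMatrix a m e S := by
  ext (_ | i) (_ | j)
  · simp only [Matrix.sum_apply, borderMatrix, Matrix.of_apply, Matrix.smul_apply, smul_eq_mul]
    rw [← Finset.mul_sum, sum_compl_indepSum]; ring
  · simp only [Matrix.sum_apply, borderMatrix, Matrix.of_apply, Matrix.smul_apply, smul_eq_mul]
    rw [← Finset.mul_sum, sum_compl_linkDeg]; push_cast; ring
  · simp only [Matrix.sum_apply, borderMatrix, Matrix.of_apply, Matrix.smul_apply, smul_eq_mul]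
    rw [← Finset.mul_sum, sum_compl_linkDeg]; push_cast; ring
  · have h := congrFun (congrFun (sum_compl_linkMatrix (M := M) (a := a) (e + 2) S) i) j
    simp only [Matrix.sum_apply, borderMatrix, Matrix.of_apply, Matrix.smul_apply,
      smul_eq_mul] at h ⊢
    rw [h]; push_cast; ring

theorem borderMatrix_eq_zero_of_not_indep {S : Finset α} (hS : ¬ M.Indep (S : Set α)) :
    M.borderMatrix a m e S = 0 := by
  have hdeg : ∀ i, M.linkDeg a (e + 1) S i = 0 := fun i =>
    linkDeg_eq_zero (fun h => hS ((mem_linkVerts.1 h).2.subset (by simp))) _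
  ext (_ | i) (_ | j) <;>
    simp [borderMatrix, indepSum_eq_zero hS, hdeg, linkMatrix_eq_zero_of_not_indep hS]

/-- The linear system for a vector with last coordinate `1` on which all rows of the bordered
Hessian but the last one vanish is solvable: its right-hand side is orthogonal to the kernel of
the Hessian. -/
theorem dotProduct_linkDeg_eq_zero (ha : ∀ i, 0 < a i) (hr : ((e + 2 : ℕ) : ℕ∞) ≤ M.eRank)
    {S : Finset α} (hS : S.card ≤ e) {u : α → ℝ} (hu : M.linkMatrix a (e + 2) S *ᵥ u = 0) :
    u ⬝ᵥ M.linkDeg a (e + 1) S = 0 := by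
  obtain ⟨k, hk⟩ := Nat.exists_eq_add_of_le hS
  induction k generalizing S with
  | zero =>
    by_cases hI : M.Indep (S : Set α)
    · have h := (sum_linkVerts_eq_zero ha (by omega) hI hr hu).1
      rw [dotProduct, ← Finset.sum_subset (Finset.subset_univ (M.linkVerts S)),
        ← mul_zero (∏ l ∈ S, a l), ← h, Finset.mul_sum]
      · refine Finset.sum_congr rfl fun i hi => ?_
        rw [linkDeg_of_card_add_one (by omega) hi]; ring
      · intro i _ hi
        rw [linkDeg_eq_zero hi, mul_zero]
    · refine Finset.sum_eq_zero fun i _ => ?_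
      rw [linkDeg_eq_zero fun h => hI ((mem_linkVerts.1 h).2.subset (by simp)), mul_zero]
  | succ k ih =>
    have h : ∀ l ∈ Sᶜ, u ⬝ᵥ M.linkDeg a (e + 1) (insert l S) = 0 := by
      intro l hl
      rw [Finset.mem_compl] at hl
      have hc := Finset.card_insert_of_notMem hl
      exact ih (by omega) (linkMatrix_insert_mulVec_eq_zero ha hr (by omega) hu hl) (by omega)
    have h2 := Finset.sum_eq_zero h
    rw [← dotProduct_sum] at h2
    have h3 : ∑ l ∈ Sᶜ, M.linkDeg a (e + 1) (insert l S) =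
        (e - S.card : ℝ) • M.linkDeg a (e + 1) S := by
      ext i
      rw [Finset.sum_apply, sum_compl_linkDeg, Pi.smul_apply, smul_eq_mul]
      push_cast; ring
    rw [h3, dotProduct_smul, smul_eq_mul] at h2
    refine (mul_eq_zero.1 h2).resolve_left ?_
    rw [hk]; push_cast
    have : (0 : ℝ) ≤ k := Nat.cast_nonneg k
    linarith

theorem exists_borderMatrix_mulVec_some_eq_zero (ha : ∀ i, 0 < a i)
    (hr : ((e + 2 : ℕ) : ℕ∞) ≤ M.eRank) {S : Finset α} (hS : S.card ≤ e) :
    ∃ w : Option α → ℝ, w none = 1 ∧ ∀ i, (M.borderMatrix a m e S *ᵥ w) (some i) = 0 := by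
  obtain ⟨v, hv⟩ := (linkMatrix_isSymm (M := M) (a := a) (e + 2) S).exists_mulVec_eq
    (b := -(m + 1 : ℝ) • M.linkDeg a (e + 1) S) fun u hu => by
      rw [dotProduct_smul, dotProduct_linkDeg_eq_zero ha hr hS hu, smul_zero]
  refine ⟨fun o => o.elim 1 v, rfl, fun i => ?_⟩
  rw [borderMatrix_mulVec_some]
  simp only [Option.elim, hv, Pi.smul_apply, smul_eq_mul]
  ring

/-- If all rows but the last one vanish on `w`, only the last row contributes. -/
theorem dotProduct_borderMatrix_mulVec_of_some_eq_zero {S : Finset α} {w : Option α → ℝ}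
    (hw : ∀ i, (M.borderMatrix a m e S *ᵥ w) (some i) = 0) (u : Option α → ℝ) :
    u ⬝ᵥ M.borderMatrix a m e S *ᵥ w = u none * (M.borderMatrix a m e S *ᵥ w) none := by
  simp [dotProduct, Fintype.sum_option, hw]

/-- A vector orthogonal to all old variables on which the bordered Hessian is nonpositive reduces
hyperbolicity of the bordered Hessian to that of the Hessian. -/
theorem hyperbolicAt_borderMatrix_of_nonpos {S : Finset α}
    (hyp : (M.linkMatrix a (e + 2) S).HyperbolicAt 1) {w : Option α → ℝ} (hw1 : w none = 1)
    (hw : ∀ i, (M.borderMatrix a m e S *ᵥ w) (some i) = 0)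
    (hneg : w ⬝ᵥ M.borderMatrix a m e S *ᵥ w ≤ 0) :
    (M.borderMatrix a m e S).HyperbolicAt (basePoint α) := by
  intro x hx
  set u := x - x none • w with hu
  have hxu : x = u + x none • w := by simp [hu]
  have hu0 : u none = 0 := by simp [hu, hw1]
  have hbase : basePoint α ⬝ᵥ M.borderMatrix a m e S *ᵥ w = 0 := by
    rw [dotProduct_borderMatrix_mulVec_of_some_eq_zero hw]; simp [basePoint]
  have hrow : ∀ i, (M.borderMatrix a m e S *ᵥ u) (some i) =
      (M.linkMatrix a (e + 2) S *ᵥ fun i => u (some i)) i := fun i => by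
    rw [borderMatrix_mulVec_some, hu0]; ring
  have h1 : (1 : α → ℝ) ⬝ᵥ M.linkMatrix a (e + 2) S *ᵥ (fun i => u (some i)) = 0 := by
    rw [hxu, Matrix.mulVec_add, Matrix.mulVec_smul, dotProduct_add, dotProduct_smul, hbase,
      smul_zero, add_zero, basePoint_dotProduct] at hx
    simp_rw [hrow] at hx
    rw [one_dotProduct, hx]
  have h2 := hyp _ h1
  have h3 : u ⬝ᵥ M.borderMatrix a m e S *ᵥ u =
      (fun i => u (some i)) ⬝ᵥ M.linkMatrix a (e + 2) S *ᵥ (fun i => u (some i)) := by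
    rw [dotProduct, Fintype.sum_option, hu0, zero_mul, zero_add, dotProduct]
    simp_rw [hrow]
  rw [hxu, (borderMatrix_isSymm S).quadratic_add_smul, h3,
    dotProduct_borderMatrix_mulVec_of_some_eq_zero hw u, hu0]
  nlinarith [sq_nonneg (x none)]

/-- In corank two the value of the bordered Hessian at the solution `w` of the linear system is a
positive multiple of `p - (m + 2)`, where `p` is the number of parallel classes of the link. -/
theorem mul_borderMatrix_of_card_eq (ha : ∀ i, 0 < a i) {S : Finset α} (hS : S.card = e)
    (hI : M.Indep (S : Set α)) {w : Option α → ℝ} (hw1 : w none = 1)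
    (hw : ∀ i, (M.borderMatrix a m e S *ᵥ w) (some i) = 0) :
    ((M.linkFlats S).card - 1 : ℝ) * (w ⬝ᵥ M.borderMatrix a m e S *ᵥ w) =
      (∏ l ∈ S, a l) * (m + 1) * ((M.linkFlats S).card - (m + 2)) := by
  set P := ∏ l ∈ S, a l with hP
  have hP0 : 0 < P := Finset.prod_pos fun i _ => ha i
  set T := ∑ i ∈ M.linkVerts S, a i * w (some i) with hT
  have hcl : ∀ i ∈ M.linkVerts S, M.classSum S (fun j => a j * w (some j))
      (M.closure (insert i S : Finset α)) = T + (m + 1) := by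
    intro i hi
    have h := hw i
    rw [borderMatrix_mulVec_some, hw1, linkMatrix_mulVec_of_card_add_two (by omega) hi,
      linkDeg_of_card_add_one (by omega) hi, ← hP, ← hT] at h
    have h2 : P * a i * ((m + 1) + (T - M.classSum S (fun j => a j * w (some j))
      (M.closure (insert i S : Finset α)))) = 0 := by rw [← h]; ring
    have := (mul_eq_zero.1 h2).resolve_left (mul_pos hP0 (ha i)).ne'
    linarith
  have hTp := sum_linkVerts_eq_card_mul hcl
  rw [← hT] at hTp
  have hdeg : (M.linkDeg a (e + 1) S ⬝ᵥ fun i => w (some i)) = P * T := by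
    rw [dotProduct, ← Finset.sum_subset (Finset.subset_univ (M.linkVerts S)), hT, Finset.mul_sum]
    · refine Finset.sum_congr rfl fun i hi => ?_
      rw [linkDeg_of_card_add_one (by omega) hi]; ring
    · intro i _ hi
      rw [linkDeg_eq_zero hi, zero_mul]
  rw [dotProduct_borderMatrix_mulVec_of_some_eq_zero hw, hw1, borderMatrix_mulVec_none, hw1, hdeg,
    indepSum_of_card_eq hS hI, ← hP]
  set p : ℝ := ((M.linkFlats S).card : ℝ)
  have hkey : (p - 1) * (T + (m + 2)) = p - (m + 2) := by linarith
  calc _ = P * (m + 1) * ((p - 1) * (T + (m + 2))) := by ring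
    _ = _ := by rw [hkey]

theorem card_linkFlats_le (S : Finset α) : (M.linkFlats S).card ≤ (M.linkVerts S).card := by
  classical exact Finset.card_image_le

theorem card_linkVerts_add_card_le (S : Finset α) :
    (M.linkVerts S).card + S.card ≤ Fintype.card α := by
  have h : M.linkVerts S ⊆ Sᶜ := fun i hi => Finset.mem_compl.2 (mem_linkVerts.1 hi).1
  have := Finset.card_le_card h
  rw [Finset.card_compl] at this
  have := S.card_le_univ
  omega

/-- The two statements are proved together: contracting a further element `l` makes `w` orthogonal
to the base point, so that hyperbolicity of the contractions gives the sign at `w`, and the sign at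
`w` gives hyperbolicity. The bound on the number of elements is used in corank two, where there are
at most `m + 2` parallel classes. -/
theorem borderMatrix_nonpos_and_hyperbolicAt (ha : ∀ i, 0 < a i)
    (hr : ((e + 2 : ℕ) : ℕ∞) ≤ M.eRank) (hm : Fintype.card α ≤ m + (e + 2)) {S : Finset α}
    (hS : S.card ≤ e) :
    (∀ w : Option α → ℝ, w none = 1 → (∀ i, (M.borderMatrix a m e S *ᵥ w) (some i) = 0) →
      w ⬝ᵥ M.borderMatrix a m e S *ᵥ w ≤ 0) ∧
    (M.borderMatrix a m e S).HyperbolicAt (basePoint α) := by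
  obtain ⟨k, hk⟩ := Nat.exists_eq_add_of_le hS
  induction k generalizing S with
  | zero =>
    by_cases hI : M.Indep (S : Set α)
    swap
    · rw [borderMatrix_eq_zero_of_not_indep hI]
      exact ⟨by simp, Matrix.hyperbolicAt_zero _⟩
    have hneg : ∀ w : Option α → ℝ, w none = 1 →
        (∀ i, (M.borderMatrix a m e S *ᵥ w) (some i) = 0) →
        w ⬝ᵥ M.borderMatrix a m e S *ᵥ w ≤ 0 := by
      intro w hw1 hw
      have h := mul_borderMatrix_of_card_eq ha (by omega) hI hw1 hw
      have hp : (1 : ℝ) < (M.linkFlats S).card := by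
        exact_mod_cast one_lt_card_linkFlats hI (le_trans (by norm_cast; omega) hr)
      have hp2 : ((M.linkFlats S).card : ℝ) ≤ m + 2 := by
        have h1 := card_linkFlats_le (M := M) S
        have h2 := card_linkVerts_add_card_le (M := M) S
        exact_mod_cast (by omega : (M.linkFlats S).card ≤ m + 2)
      have hP0 : 0 < ∏ l ∈ S, a l := Finset.prod_pos fun i _ => ha i
      have h3 : (∏ l ∈ S, a l) * (m + 1) * ((M.linkFlats S).card - (m + 2) : ℝ) ≤ 0 :=
        mul_nonpos_of_nonneg_of_nonpos (by positivity) (by linarith)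
      rw [← h] at h3
      exact nonpos_of_mul_nonpos_right h3 (by linarith)
    obtain ⟨w, hw1, hw⟩ := exists_borderMatrix_mulVec_some_eq_zero (m := m) ha hr hS
    exact ⟨hneg, hyperbolicAt_borderMatrix_of_nonpos (hyperbolicAt_linkMatrix ha hr (by omega))
      hw1 hw (hneg w hw1 hw)⟩
  | succ k ih =>
    have hneg : ∀ w : Option α → ℝ, w none = 1 →
        (∀ i, (M.borderMatrix a m e S *ᵥ w) (some i) = 0) →
        w ⬝ᵥ M.borderMatrix a m e S *ᵥ w ≤ 0 := by
      intro w hw1 hw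
      have h : ∑ l ∈ Sᶜ, w ⬝ᵥ M.borderMatrix a m e (insert l S) *ᵥ w ≤ 0 := by
        refine Finset.sum_nonpos fun l hl => ?_
        rw [Finset.mem_compl] at hl
        have hc := Finset.card_insert_of_notMem hl
        refine (ih (by omega) (by omega)).2 w ?_
        rw [basePoint_dotProduct_borderMatrix_insert_mulVec hl, hw, mul_zero]
      rw [← dotProduct_sum, ← Matrix.sum_mulVec, sum_compl_borderMatrix, Matrix.smul_mulVec,
        dotProduct_smul, smul_eq_mul] at h
      refine nonpos_of_mul_nonpos_right h ?_
      rw [hk]; push_cast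
      have : (0 : ℝ) ≤ k := Nat.cast_nonneg k
      linarith
    obtain ⟨w, hw1, hw⟩ := exists_borderMatrix_mulVec_some_eq_zero (m := m) ha hr hS
    exact ⟨hneg, hyperbolicAt_borderMatrix_of_nonpos (hyperbolicAt_linkMatrix ha hr (by omega))
      hw1 hw (hneg w hw1 hw)⟩

/-- The bordered Hessians of the contractions are nonpositive at `w` and average to zero there, so
each of them vanishes at `w`, which then lies in its kernel. -/
theorem borderMatrix_insert_mulVec_eq_zero (ha : ∀ i, 0 < a i)
    (hr : ((e + 2 : ℕ) : ℕ∞) ≤ M.eRank) (hm : Fintype.card α ≤ m + (e + 2)) {S : Finset α}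
    (hS : S.card + 1 ≤ e) {w : Option α → ℝ}
    (hw : ∀ i, (M.borderMatrix a m e S *ᵥ w) (some i) = 0)
    (h0 : w ⬝ᵥ M.borderMatrix a m e S *ᵥ w = 0) {l : α} (hl : l ∉ S) :
    M.borderMatrix a m e (insert l S) *ᵥ w = 0 := by
  by_cases hI : M.Indep (insert l S : Finset α)
  swap
  · simp [borderMatrix_eq_zero_of_not_indep hI]
  have hbase : ∀ i ∉ S, basePoint α ⬝ᵥ M.borderMatrix a m e (insert i S) *ᵥ w = 0 := by
    intro i hi
    rw [basePoint_dotProduct_borderMatrix_insert_mulVec hi, hw, mul_zero]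
  have hyp : ∀ i ∉ S, (M.borderMatrix a m e (insert i S)).HyperbolicAt (basePoint α) :=
    fun i hi => (borderMatrix_nonpos_and_hyperbolicAt ha hr hm
      (by rw [Finset.card_insert_of_notMem hi]; omega)).2
  have hsum : ∑ i ∈ Sᶜ, w ⬝ᵥ M.borderMatrix a m e (insert i S) *ᵥ w = 0 := by
    rw [← dotProduct_sum, ← Matrix.sum_mulVec, sum_compl_borderMatrix, Matrix.smul_mulVec,
      dotProduct_smul, h0, smul_zero]
  have hz := (Finset.sum_eq_zero_iff_of_nonpos fun i hi => hyp i (Finset.mem_compl.1 hi) w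
    (hbase i (Finset.mem_compl.1 hi))).1 hsum l (Finset.mem_compl.2 hl)
  refine (hyp l hl).mulVec_eq_zero (borderMatrix_isSymm _) ?_ (hbase l hl) hz
  rw [basePoint_dotProduct_borderMatrix_mulVec_basePoint]
  exact one_dotProduct_linkMatrix_mulVec_one_pos ha hr
    (by rw [Finset.card_insert_of_notMem hl]; omega) hI

theorem borderMatrix_eq_zero_of_empty (ha : ∀ i, 0 < a i)
    (hr : ((e + 2 : ℕ) : ℕ∞) ≤ M.eRank) (hm : Fintype.card α ≤ m + (e + 2))
    {w : Option α → ℝ} (hw : ∀ i, (M.borderMatrix a m e ∅ *ᵥ w) (some i) = 0)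
    (h0 : w ⬝ᵥ M.borderMatrix a m e ∅ *ᵥ w = 0) (S : Finset α) (hS : S.card ≤ e) :
    (∀ i, (M.borderMatrix a m e S *ᵥ w) (some i) = 0) ∧
      w ⬝ᵥ M.borderMatrix a m e S *ᵥ w = 0 := by
  induction S using Finset.induction_on with
  | empty => exact ⟨hw, h0⟩
  | insert l S hl ih =>
    rw [Finset.card_insert_of_notMem hl] at hS
    obtain ⟨h1, h2⟩ := ih (by omega)
    have h := borderMatrix_insert_mulVec_eq_zero ha hr hm hS h1 h2 hl
    simp [h]

/-- If the bordered Hessian vanishes at the solution `w` of the linear system, then every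
independent set of size `e` leaves as many parallel classes as elements, so that any two further
elements extend it. -/
theorem indep_insert_insert_of_borderMatrix_eq_zero (ha : ∀ i, 0 < a i)
    (hr : ((e + 2 : ℕ) : ℕ∞) ≤ M.eRank) (hm : Fintype.card α = m + (e + 2))
    {w : Option α → ℝ} (hw1 : w none = 1)
    (hw : ∀ i, (M.borderMatrix a m e ∅ *ᵥ w) (some i) = 0)
    (h0 : w ⬝ᵥ M.borderMatrix a m e ∅ *ᵥ w = 0) {S : Finset α} (hS : S.card = e)
    (hI : M.Indep (S : Set α)) {i j : α} (hi : i ∉ S) (hj : j ∉ S) (hij : i ≠ j) :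
    M.Indep (insert i (insert j S) : Finset α) := by
  classical
  obtain ⟨h1, h2⟩ := borderMatrix_eq_zero_of_empty ha hr hm.le hw h0 S hS.le
  have h := mul_borderMatrix_of_card_eq ha hS hI hw1 h1
  rw [h2, mul_zero] at h
  have hP0 : 0 < ∏ l ∈ S, a l := Finset.prod_pos fun i _ => ha i
  have hp := (mul_eq_zero.1 h.symm).resolve_left (by positivity)
  have hcard : (M.linkFlats S).card = m + 2 := by
    have : ((M.linkFlats S).card : ℝ) = m + 2 := by linarith
    exact_mod_cast this
  have hle := card_linkFlats_le (M := M) S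
  have hle2 := card_linkVerts_add_card_le (M := M) S
  have hN : M.linkVerts S = Sᶜ := by
    refine Finset.eq_of_subset_of_card_le
      (fun i hi => Finset.mem_compl.2 (mem_linkVerts.1 hi).1) ?_
    rw [Finset.card_compl]
    omega
  have hinj : Set.InjOn (fun i => M.closure (insert i S : Finset α)) (M.linkVerts S) := by
    rw [← Finset.card_image_iff]
    exact le_antisymm Finset.card_image_le (by change _ ≤ (M.linkFlats S).card; omega)
  have hi' : i ∈ M.linkVerts S := by rw [hN]; exact Finset.mem_compl.2 hi
  have hj' : j ∈ M.linkVerts S := by rw [hN]; exact Finset.mem_compl.2 hj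
  exact ((indep_insert_insert_iff hi' hj').2 fun heq => hij (hinj hi' hj' heq)).2

end Matroid

/-! ### Parallel classes and circuits -/

namespace Matroid

theorem mem_parallelClass_iff {α : Type*} {M : Matroid α} {e : α} (he : M.IsNonloop e) (f : α) :
    (f = e ∨ M.IsParallel e f) ↔ M.closure {e} = M.closure {f} := by
  by_cases h : e = f
  · simp [h]
  · rw [he.closure_eq_closure_iff_isCircuit_of_ne h, IsParallel]
    simp [h, Ne.symm h]

/-- Among three parallel classes one differs from those of `i` and `j`. -/
theorem exists_isNonloop_closure_ne {α : Type*} {M : Matroid α}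
    (h3 : 3 ≤ M.parallelClasses.ncard) (i j : α) :
    ∃ l, M.IsNonloop l ∧ M.closure {i} ≠ M.closure {l} ∧ M.closure {j} ≠ M.closure {l} := by
  by_contra! hcon
  have hsub : M.parallelClasses ⊆
      {{f | M.closure {i} = M.closure {f}}, {f | M.closure {j} = M.closure {f}}} := by
    rintro P ⟨e, he, rfl⟩
    simp_rw [mem_parallelClass_iff he]
    by_cases hi : M.closure {i} = M.closure {e}
    · left; rw [hi]
    · right; rw [Set.mem_singleton_iff, hcon e he hi]
  have h1 := Set.ncard_le_ncard hsub (Set.toFinite _)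
  have h2 := Set.ncard_insert_le {f | M.closure {i} = M.closure {f}}
    {{f | M.closure {j} = M.closure {f}}}
  rw [Set.ncard_singleton] at h2
  omega

theorem exists_isCircuit_of_girth_le {α : Type*} {M : Matroid α} {k : ℕ}
    (h : M.girth ≤ (k : ℕ∞) + 1) : ∃ C, M.IsCircuit C ∧ C.encard ≤ (k : ℕ∞) + 1 := by
  by_contra! hcon
  have h1 : ((k + 1 : ℕ) : ℕ∞) + 1 ≤ M.girth :=
    le_iInf₂ fun C hC => Order.add_one_le_of_lt (by exact_mod_cast hcon C hC)
  have h2 := h1.trans h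
  norm_cast at h2
  omega

variable {α : Type*} [Fintype α] [DecidableEq α] {M : Matroid α} {a : α → ℝ}

/-- Some contraction of `M` to rank two has a parallel class that avoids `i` and `j`. In rank
at least three one contracts `i` and leaves `j`. -/
theorem exists_linkVerts_avoiding {r : ℕ} (hr : 2 ≤ r) (hM : M.eRank = r)
    (h3 : 3 ≤ M.parallelClasses.ncard) {i j : α} (hij : i ≠ j)
    (hI : M.Indep ({i, j} : Finset α)) :
    ∃ S : Finset α, S.card + 2 = r ∧ M.Indep (S : Set α) ∧ ∃ l ∈ M.linkVerts S,
      ∀ x ∈ M.linkVerts S, M.closure (insert x S : Finset α) = M.closure (insert l S : Finset α) →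
        x ≠ i ∧ x ≠ j := by
  rcases hr.eq_or_lt with rfl | hr
  · obtain ⟨l, hl, hli, hlj⟩ := exists_isNonloop_closure_ne h3 i j
    refine ⟨∅, by simp, by simp, l, mem_linkVerts.2 ⟨by simp, by simpa using hl⟩, ?_⟩
    intro x _ hx
    simp only [insert_empty_eq, Finset.coe_singleton] at hx
    exact ⟨by rintro rfl; exact hli hx, by rintro rfl; exact hlj hx⟩
  · have hc : ({i, j} : Finset α).card = 2 := Finset.card_pair hij
    obtain ⟨l, hl⟩ := hI.exists_mem_linkVerts (by rw [hM, hc]; exact_mod_cast hr)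
    obtain ⟨hlS, hlI⟩ := mem_linkVerts.1 hl
    obtain ⟨B, hB, hBI, hBc⟩ := hlI.exists_superset_card_eq (d := r)
      (by rw [Finset.card_insert_of_notMem hlS]; omega) hM.ge
    simp only [Finset.mem_insert, Finset.mem_singleton, not_or] at hlS
    have hlB : l ∈ B := hB (by simp)
    have hiB : i ∈ B := hB (by simp)
    have hjB : j ∈ B := hB (by simp)
    set S := (B.erase j).erase l with hS
    have hlj : l ∈ B.erase j := Finset.mem_erase.2 ⟨hlS.2, hlB⟩
    have hins : insert l S = B.erase j := Finset.insert_erase hlj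
    have hins2 : insert j (insert l S) = B := by rw [hins, Finset.insert_erase hjB]
    have hSB : S ⊆ B := (Finset.erase_subset _ _).trans (Finset.erase_subset _ _)
    have hjS : j ∉ S := by simp [hS]
    have hiS : i ∈ S := by simp [hS, hij, hiB, Ne.symm hlS.1]
    have hlN : l ∈ M.linkVerts S := mem_linkVerts.2 ⟨by simp [hS], by
      rw [hins]; exact hBI.subset (Finset.coe_subset.2 (Finset.erase_subset _ _))⟩
    refine ⟨S, ?_, hBI.subset (Finset.coe_subset.2 hSB), l, hlN, ?_⟩
    · rw [hS, Finset.card_erase_of_mem hlj, Finset.card_erase_of_mem hjB]; omega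
    · intro x hx hxl
      refine ⟨by rintro rfl; exact (mem_linkVerts.1 hx).1 hiS, ?_⟩
      rintro rfl
      exact (indep_insert_insert_iff hx hlN).1 ⟨Ne.symm hlS.2, by rwa [hins2]⟩ hxl

/-! ### The strict inequalities for weighted counts -/

/-- The reversed Cauchy–Schwarz inequality for the Hessian `H` of the basis generating polynomial
`f`, applied to the base point `1` and `f_j e_i + f_i e_j`. In the case of equality a vector
`f_j e_i + f_i e_j - c 1` with `c > 0` lies in the kernel of `H`, hence in the kernels of all
iterated derivatives of corank two, whose elements have vanishing class sums. -/
theorem mul_indepSum_pair_lt (ha : ∀ i, 0 < a i) {r : ℕ} (hr : 2 ≤ r) (hM : M.eRank = r)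
    (h3 : 3 ≤ M.parallelClasses.ncard) {i j : α} (hij : i ≠ j)
    (hI : M.Indep ({i, j} : Finset α)) :
    (r : ℝ) * (M.indepSum a r ∅ * M.indepSum a r {i, j}) <
      2 * (r - 1) * (M.indepSum a r {i} * M.indepSum a r {j}) := by
  have hrr : (r : ℕ∞) ≤ M.eRank := hM.ge
  have hr' : (2 : ℝ) ≤ r := by exact_mod_cast hr
  have hF : 0 < M.indepSum a r ∅ := indepSum_pos ha (by simp) (by simp) hrr
  have hFi : 0 < M.indepSum a r {i} := indepSum_pos ha (hI.subset (by simp)) (by simp; omega) hrr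
  have hFj : 0 < M.indepSum a r {j} := indepSum_pos ha (hI.subset (by simp)) (by simp; omega) hrr
  set H := M.linkMatrix a r ∅ with hH
  set v : α → ℝ := M.indepSum a r {j} • Pi.single i 1 + M.indepSum a r {i} • Pi.single j 1 with hv
  have hHij : ∀ x y, H x y = if x = y then 0 else M.indepSum a r {x, y} := by
    intro x y
    rw [hH, linkMatrix_apply]
    simp
  have h11 : (1 : α → ℝ) ⬝ᵥ H *ᵥ 1 = (r - 1 : ℝ) * (r * M.indepSum a r ∅) := by
    rw [hH, one_dotProduct_linkMatrix_mulVec_one]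
    simp
  have h1v : (1 : α → ℝ) ⬝ᵥ H *ᵥ v =
      (r - 1 : ℝ) * (2 * (M.indepSum a r {i} * M.indepSum a r {j})) := by
    rw [hH, one_dotProduct_linkMatrix_mulVec, hv]
    simp only [dotProduct_add, dotProduct_smul, dotProduct_single, linkDeg, Finset.notMem_empty,
      if_false, insert_empty_eq, smul_eq_mul, Finset.card_empty, Nat.cast_zero]
    ring
  have hvv : v ⬝ᵥ H *ᵥ v =
      2 * (M.indepSum a r {i} * M.indepSum a r {j} * M.indepSum a r {i, j}) := by
    rw [hv]
    simp only [Matrix.mulVec_add, Matrix.mulVec_smul, add_dotProduct, dotProduct_add,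
      smul_dotProduct, dotProduct_smul, single_dotProduct, Matrix.mulVec_single, hHij,
      smul_eq_mul, Matrix.col_apply, MulOpposite.smul_eq_mul_unop]
    simp [hij, hij.symm, Finset.pair_comm j i]
    ring
  have hpos : 0 < (1 : α → ℝ) ⬝ᵥ H *ᵥ 1 :=
    one_dotProduct_linkMatrix_mulVec_one_pos ha hrr (by simpa using hr) (by simp)
  have h1vpos : 0 < (1 : α → ℝ) ⬝ᵥ H *ᵥ v := by
    rw [h1v]
    exact mul_pos (by linarith) (by positivity)
  have hlt := (hyperbolicAt_linkMatrix ha hrr (S := ∅) (by simpa using hr)).mul_lt_sq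
    (linkMatrix_isSymm r ∅) hpos (v := v) ?_
  · rw [← hH, h11, h1v, hvv] at hlt
    set F := M.indepSum a r ∅
    set Fi := M.indepSum a r {i}
    set Fj := M.indepSum a r {j}
    set Fij := M.indepSum a r {i, j}
    have hc : 0 < (r - 1) * 2 * (Fi * Fj) := mul_pos (by linarith) (by positivity)
    refine lt_of_mul_lt_mul_left ?_ hc.le
    calc _ = _ := by ring
      _ < _ := hlt
      _ = _ := by ring
  · rw [← hH]
    set c := (1 : α → ℝ) ⬝ᵥ H *ᵥ v / 1 ⬝ᵥ H *ᵥ 1 with hc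
    have hc0 : 0 < c := div_pos h1vpos hpos
    intro hker
    obtain ⟨S, hSc, hSI, l, hl, hav⟩ := exists_linkVerts_avoiding hr hM h3 hij hI
    have hkS := linkMatrix_mulVec_eq_zero_of_empty ha hrr hker S (by omega)
    have hcl := (sum_linkVerts_eq_zero ha hSc hSI hrr hkS).2 l hl
    -- on a class that avoids `i` and `j` the kernel vector is the constant `-c`
    refine absurd hcl (ne_of_lt ?_)
    refine Finset.sum_neg ?_ ⟨l, by simp [hl]⟩
    intro x hx
    obtain ⟨hxN, hxl⟩ := Finset.mem_filter.1 hx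
    obtain ⟨hxi, hxj⟩ := hav x hxN hxl
    have : (v + -c • (1 : α → ℝ)) x = -c := by
      simp [hv, hxi, hxj]
    rw [this]
    exact mul_neg_of_pos_of_neg (ha x) (by linarith)

/-- The reversed Cauchy–Schwarz inequality for the bordered Hessian, applied to the base point and
the homogenizing variable. It is strict because the bordered Hessian is negative at the solution
`w` of the linear system unless every circuit has more than `e + 2` elements. -/
theorem mul_indepSum_lt_sq (ha : ∀ i, 0 < a i) {m e : ℕ} (hr : ((e + 2 : ℕ) : ℕ∞) ≤ M.eRank)
    (hm : Fintype.card α = m + (e + 2)) {C : Set α} (hC : M.IsCircuit C)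
    (hCe : C.encard ≤ (e + 2 : ℕ)) :
    (e + 2 : ℝ) * (m + 2) * (M.indepSum a e ∅ * M.indepSum a (e + 2) ∅) <
      (m + 1) * (e + 1) * M.indepSum a (e + 1) ∅ ^ 2 := by
  obtain ⟨w, hw1, hw⟩ := exists_borderMatrix_mulVec_some_eq_zero (M := M) (a := a) (m := m) ha hr
    (S := ∅) (by simp)
  have hneg : w ⬝ᵥ M.borderMatrix a m e ∅ *ᵥ w < 0 := by
    refine lt_of_le_of_ne ((borderMatrix_nonpos_and_hyperbolicAt ha hr hm.le (by simp)).1 w hw1 hw)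
      fun h0 => ?_
    -- a circuit `C`, with `C \ {x}` extended to an independent set `I` of size `e + 1`, makes
    -- `insert x I` a dependent set of size `e + 2`
    obtain ⟨x, hx⟩ := hC.nonempty
    have hCx := hC.sdiff_singleton_indep hx
    lift C to Finset α using C.toFinite
    rw [Set.encard_coe_eq_coe_finsetCard] at hCe
    have hCe' : C.card ≤ e + 2 := by exact_mod_cast hCe
    rw [Finset.mem_coe] at hx
    have hcoe : (C : Set α) \ {x} = (C.erase x : Finset α) := by push_cast; rfl
    rw [hcoe] at hCx
    obtain ⟨I, hCI, hI, hIc⟩ := hCx.exists_superset_card_eq (d := e + 1)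
      (by rw [Finset.card_erase_of_mem hx]; omega) (le_trans (by norm_cast; omega) hr)
    have hdep : ¬ M.Indep (insert x I : Finset α) := by
      refine fun h => hC.not_indep (h.subset (Finset.coe_subset.2 fun z hz => ?_))
      by_cases hzx : z = x
      · simp [hzx]
      · exact Finset.mem_insert_of_mem (hCI (Finset.mem_erase.2 ⟨hzx, hz⟩))
    have hxI : x ∉ I := fun h => hdep (by rwa [Finset.insert_eq_of_mem h])
    obtain ⟨y, hy⟩ : I.Nonempty := Finset.card_pos.1 (by omega)
    refine hdep ?_
    have h := indep_insert_insert_of_borderMatrix_eq_zero ha hr hm hw1 hw h0 (S := I.erase y)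
      (by rw [Finset.card_erase_of_mem hy]; omega)
      (hI.subset (Finset.coe_subset.2 (Finset.erase_subset _ _)))
      (fun h => hxI (Finset.mem_of_mem_erase h)) (Finset.notMem_erase y I)
      (fun h => hxI (h ▸ hy))
    rwa [Finset.insert_erase hy] at h
  -- with `w = (v, 1)`, the vectors `(0, 1)` and `(-v, 0)` differ by `w`, which is orthogonal to
  -- all old variables
  set v : α → ℝ := fun i => w (some i) with hv
  set H := M.linkMatrix a (e + 2) ∅ with hH
  have hrow : H *ᵥ v = -(m + 1 : ℝ) • M.linkDeg a (e + 1) ∅ := by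
    ext i
    have h := hw i
    rw [borderMatrix_mulVec_some, hw1] at h
    rw [Pi.smul_apply, smul_eq_mul]
    linarith
  have h1v : (1 : α → ℝ) ⬝ᵥ H *ᵥ v = -(m + 1 : ℝ) * ((e + 1) * M.indepSum a (e + 1) ∅) := by
    rw [hrow, dotProduct_smul, one_dotProduct, sum_linkDeg]
    simp
  have hvv : v ⬝ᵥ H *ᵥ v = -(m + 1 : ℝ) * (M.linkDeg a (e + 1) ∅ ⬝ᵥ v) := by
    rw [hrow, dotProduct_smul, smul_eq_mul, dotProduct_comm]
  rw [dotProduct_borderMatrix_mulVec_of_some_eq_zero hw, hw1, borderMatrix_mulVec_none, hw1]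
    at hneg
  have h11 : (1 : α → ℝ) ⬝ᵥ H *ᵥ 1 = (e + 1 : ℝ) * ((e + 2) * M.indepSum a (e + 2) ∅) := by
    rw [hH, one_dotProduct_linkMatrix_mulVec_one]
    simp only [Finset.card_empty, Nat.cast_zero]
    push_cast
    ring
  have hpos : 0 < (1 : α → ℝ) ⬝ᵥ H *ᵥ 1 :=
    one_dotProduct_linkMatrix_mulVec_one_pos ha hr (by simp) (by simp)
  have hle := (hyperbolicAt_linkMatrix ha hr (S := ∅) (by simp)).mul_le_sq
    (linkMatrix_isSymm _ ∅) hpos v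
  rw [← hH, h1v] at hle
  have hlt : ((1 : α → ℝ) ⬝ᵥ H *ᵥ 1) * ((m + 2 : ℝ) * (m + 1) * M.indepSum a e ∅) <
      (-(m + 1 : ℝ) * ((e + 1) * M.indepSum a (e + 1) ∅)) ^ 2 := by
    refine lt_of_lt_of_le (mul_lt_mul_of_pos_left ?_ hpos) hle
    rw [hvv]
    linarith
  rw [h11] at hlt
  have hc : (0 : ℝ) < (m + 1) * (e + 1) := by positivity
  refine lt_of_mul_lt_mul_left ?_ hc.le
  calc _ = _ := by ring
    _ < _ := hlt
    _ = _ := by ring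

/-! ### Evaluating the generating polynomials -/

open MvPolynomial in
theorem pderiv_prod_X_of_notMem {σ : Type*} {I : Finset σ} {j : σ} (hj : j ∉ I) :
    pderiv j (∏ i ∈ I, (X i : MvPolynomial σ ℝ)) = 0 := by
  classical
  induction I using Finset.induction_on with
  | empty => simp
  | insert l I hl ih =>
    rw [Finset.mem_insert, not_or] at hj
    rw [Finset.prod_insert hl, pderiv_mul, ih hj.2, pderiv_X_of_ne (Ne.symm hj.1)]
    simp

open MvPolynomial in
theorem pderiv_prod_X {σ : Type*} [DecidableEq σ] (I : Finset σ) (j : σ) :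
    pderiv j (∏ i ∈ I, (X i : MvPolynomial σ ℝ)) =
      if j ∈ I then ∏ i ∈ I.erase j, X i else 0 := by
  split_ifs with h
  · rw [← Finset.mul_prod_erase I _ h, pderiv_mul, pderiv_X_self,
      pderiv_prod_X_of_notMem (Finset.notMem_erase j I)]
    simp
  · exact pderiv_prod_X_of_notMem h

variable {n : ℕ} {N : Matroid (Fin n)} {b : Fin n → ℝ}

theorem eval_indepPoly (k : ℕ) : MvPolynomial.eval b (N.indepPoly k) = N.indepSum b k ∅ := by
  simp only [indepPoly, indepSum, map_sum, map_prod, MvPolynomial.eval_X]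
  refine Finset.sum_congr ?_ fun _ _ => rfl
  ext I
  simp

theorem basisPoly_eq_indepPoly {r : ℕ} (hN : N.eRank = r) : N.basisPoly = N.indepPoly r := by
  unfold basisPoly indepPoly
  congr 1
  ext B
  simp only [Finset.mem_filter, Finset.mem_univ, true_and]
  constructor
  · intro hB
    refine ⟨hB.indep, ?_⟩
    have := hB.encard_eq_eRank
    rw [hN, Set.encard_coe_eq_coe_finsetCard] at this
    exact_mod_cast this
  · rintro ⟨hI, hc⟩
    obtain ⟨B', hB', hsub⟩ := hI.exists_isBase_superset
    have h := hB'.encard_eq_eRank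
    rw [hN] at h
    have heq : (B : Set (Fin n)) = B' := by
      refine Set.Finite.eq_of_subset_of_encard_le (Set.toFinite _) hsub ?_
      rw [h, Set.encard_coe_eq_coe_finsetCard, hc]
    rwa [heq]

theorem eval_pderiv_indepPoly (k : ℕ) (j : Fin n) :
    MvPolynomial.eval b (MvPolynomial.pderiv j (N.indepPoly k)) * b j = N.indepSum b k {j} := by
  classical
  simp only [indepPoly, indepSum, map_sum, pderiv_prod_X]
  rw [Finset.sum_mul, Finset.sum_filter, Finset.sum_filter]
  refine Finset.sum_congr rfl fun I _ => ?_
  by_cases hI : N.Indep (I : Set (Fin n)) ∧ I.card = k <;> by_cases hj : j ∈ I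
  · simp [hI, hj, Finset.prod_erase_mul]
  · simp [hI, hj]
  · rw [if_neg hI, if_neg (by tauto)]
  · rw [if_neg hI, if_neg (by tauto)]

theorem eval_pderiv_pderiv_indepPoly (k : ℕ) {i j : Fin n} (hij : i ≠ j) :
    MvPolynomial.eval b (MvPolynomial.pderiv i (MvPolynomial.pderiv j (N.indepPoly k))) *
      (b i * b j) = N.indepSum b k {i, j} := by
  classical
  simp only [indepPoly, indepSum, map_sum, pderiv_prod_X]
  rw [Finset.sum_mul, Finset.sum_filter, Finset.sum_filter]
  refine Finset.sum_congr rfl fun I _ => ?_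
  by_cases hI : N.Indep (I : Set (Fin n)) ∧ I.card = k
  · by_cases hj : j ∈ I <;> by_cases hi : i ∈ I
    · have hi' : i ∈ I.erase j := Finset.mem_erase.2 ⟨hij, hi⟩
      rw [if_pos hI, if_pos hj, if_pos ⟨hI.1, hI.2, by simp [Finset.insert_subset_iff, hi, hj]⟩,
        pderiv_prod_X, if_pos hi', map_prod]
      simp only [MvPolynomial.eval_X]
      rw [← mul_assoc, Finset.prod_erase_mul _ _ hi', Finset.prod_erase_mul _ _ hj]
    · simp [hI, hj, hi, pderiv_prod_X, Finset.insert_subset_iff]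
    · simp [hI, hj, Finset.insert_subset_iff]
    · simp [hI, hj, Finset.insert_subset_iff]
  · rw [if_neg hI, if_neg (by tauto)]

theorem pderiv_pderiv_self_indepPoly (k : ℕ) (j : Fin n) :
    MvPolynomial.pderiv j (MvPolynomial.pderiv j (N.indepPoly k)) = 0 := by
  classical
  simp only [indepPoly, map_sum, pderiv_prod_X]
  refine Finset.sum_eq_zero fun I _ => ?_
  split_ifs
  · exact pderiv_prod_X_of_notMem (Finset.notMem_erase j I)
  · simp

end Matroid

theorem theorem4p4 (n r : ℕ) (hr : 2 ≤ r) (M : Matroid (Fin n)) (hE : M.E = Set.univ)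
    (hM : M.eRank = (r : ℕ∞)) :
    (∀ i j : Fin n, M.IsNonloop i → M.IsNonloop j → 3 ≤ M.parallelClasses.ncard →
      ∀ a : Fin n → ℝ, (∀ m, 0 < a m) →
        MvPolynomial.eval a M.basisPoly *
            MvPolynomial.eval a
              (MvPolynomial.pderiv i (MvPolynomial.pderiv j M.basisPoly)) <
          2 * (1 - 1 / (r : ℝ)) *
            MvPolynomial.eval a (MvPolynomial.pderiv i M.basisPoly) *
            MvPolynomial.eval a (MvPolynomial.pderiv j M.basisPoly)) ∧
    (∀ k : ℕ, 1 ≤ k → k ≤ r → M.girth ≤ (k : ℕ∞) + 1 →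
      ∀ a : Fin n → ℝ, (∀ m, 0 < a m) →
        (MvPolynomial.eval a (M.indepPoly (k - 1)) / (n.choose (k - 1) : ℝ)) *
            (MvPolynomial.eval a (M.indepPoly (k + 1)) / (n.choose (k + 1) : ℝ)) <
          (MvPolynomial.eval a (M.indepPoly k) / (n.choose k : ℝ)) ^ 2) := by
  have hr' : (2 : ℝ) ≤ r := by exact_mod_cast hr
  refine ⟨fun i j hi hj h3 a ha => ?_, fun k hk1 hkr hg a ha => ?_⟩
  · rw [Matroid.basisPoly_eq_indepPoly hM, Matroid.eval_indepPoly]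
    have hDpos : ∀ l, M.IsNonloop l →
        0 < MvPolynomial.eval a (MvPolynomial.pderiv l (M.indepPoly r)) := by
      intro l hl
      have h := Matroid.eval_pderiv_indepPoly (N := M) (b := a) r l
      have hpos : 0 < M.indepSum a r {l} :=
        Matroid.indepSum_pos ha (by simpa using hl) (by simp; omega) hM.ge
      rw [← h] at hpos
      exact pos_of_mul_pos_left hpos (ha l).le
    have hcoef : 0 < 2 * (1 - 1 / (r : ℝ)) := by
      have : 1 / (r : ℝ) ≤ 1 / 2 := one_div_le_one_div_of_le (by norm_num) hr'
      linarith
    have hrhs := mul_pos (mul_pos hcoef (hDpos i hi)) (hDpos j hj)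
    by_cases hij : i = j
    · subst hij
      rw [Matroid.pderiv_pderiv_self_indepPoly]
      simpa using hrhs
    have hDij := Matroid.eval_pderiv_pderiv_indepPoly (N := M) (b := a) r hij
    by_cases hI : M.Indep ({i, j} : Finset (Fin n))
    · have h := Matroid.mul_indepSum_pair_lt ha hr hM h3 hij hI
      rw [← hDij, ← Matroid.eval_pderiv_indepPoly, ← Matroid.eval_pderiv_indepPoly] at h
      set Di := MvPolynomial.eval a (MvPolynomial.pderiv i (M.indepPoly r))
      set Dj := MvPolynomial.eval a (MvPolynomial.pderiv j (M.indepPoly r))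
      set Dij := MvPolynomial.eval a
        (MvPolynomial.pderiv i (MvPolynomial.pderiv j (M.indepPoly r)))
      have hc : 0 < (r : ℝ) * (a i * a j) :=
        mul_pos (by linarith) (mul_pos (ha i) (ha j))
      refine lt_of_mul_lt_mul_left ?_ hc.le
      calc _ = _ := by ring
        _ < _ := h
        _ = _ := by field_simp
    · rw [Matroid.indepSum_eq_zero hI] at hDij
      rw [(mul_eq_zero.1 hDij).resolve_right (mul_pos (ha i) (ha j)).ne', mul_zero]
      exact hrhs
  · obtain ⟨e, rfl⟩ : ∃ e, k = e + 1 := ⟨k - 1, by omega⟩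
    rw [Nat.add_sub_cancel]
    simp only [Matroid.eval_indepPoly]
    have hrn : r ≤ n := by
      obtain ⟨B, hB⟩ := M.exists_isBase
      have h := hB.encard_eq_eRank
      lift B to Finset (Fin n) using B.toFinite
      rw [hM, Set.encard_coe_eq_coe_finsetCard] at h
      have h1 : B.card = r := by exact_mod_cast h
      have h2 := B.card_le_univ
      rw [Fintype.card_fin] at h2
      omega
    have hB : (0 : ℝ) < n.choose (e + 1) := by
      exact_mod_cast Nat.choose_pos (by omega)
    have hf : 0 < M.indepSum a (e + 1) ∅ :=
      Matroid.indepSum_pos ha (by simp) (by simp) (by rw [hM]; exact_mod_cast hkr)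
    by_cases hker : e + 1 = r
    · -- there are no independent sets of size `r + 1`
      have h0 : M.indepSum a (e + 1 + 1) ∅ = 0 := by
        refine Finset.sum_eq_zero fun I hI => ?_
        simp only [Finset.mem_filter] at hI
        have h := hI.2.1.encard_le_eRank
        rw [hM, Set.encard_coe_eq_coe_finsetCard] at h
        have h1 : I.card ≤ r := by exact_mod_cast h
        omega
      rw [h0]
      simp only [zero_div, mul_zero]
      positivity
    obtain ⟨m, rfl⟩ : ∃ m, n = m + (e + 2) := ⟨n - (e + 2), by omega⟩
    obtain ⟨C, hC, hCe⟩ := Matroid.exists_isCircuit_of_girth_le hg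
    have h := Matroid.mul_indepSum_lt_sq ha (m := m) (e := e)
      (by rw [hM]; exact_mod_cast (by omega : e + 2 ≤ r)) (by simp) hC
      (hCe.trans (by push_cast; rw [add_assoc]; norm_num))
    have hA := Nat.choose_succ_right_eq (m + (e + 2)) e
    have hC2 := Nat.choose_succ_right_eq (m + (e + 2)) (e + 1)
    rw [show m + (e + 2) - e = m + 2 by omega] at hA
    rw [show m + (e + 2) - (e + 1) = m + 1 by omega] at hC2
    have hA' : ((m + (e + 2)).choose (e + 1) : ℝ) * (e + 1) =
        (m + (e + 2)).choose e * (m + 2) := by exact_mod_cast hA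
    have hC' : ((m + (e + 2)).choose (e + 1 + 1) : ℝ) * (e + 2) =
        (m + (e + 2)).choose (e + 1) * (m + 1) := by
      have : ((m + (e + 2)).choose (e + 1 + 1) : ℝ) * (e + 1 + 1) =
        (m + (e + 2)).choose (e + 1) * (m + 1) := by exact_mod_cast hC2
      rw [← this]; ring
    set c0 : ℝ := ((m + (e + 2)).choose e : ℝ)
    set c1 : ℝ := ((m + (e + 2)).choose (e + 1) : ℝ)
    set c2 : ℝ := ((m + (e + 2)).choose (e + 1 + 1) : ℝ)
    have e0 : c0 = c1 * (e + 1) / (m + 2) := by rw [hA']; field_simp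
    have e2 : c2 = c1 * (m + 1) / (e + 2) := by rw [← hC']; field_simp
    rw [e0, e2, div_pow, lt_div_iff₀ (by positivity)]
    have hm : (0 : ℝ) < (m + 1) * (e + 1) := by positivity
    refine lt_of_mul_lt_mul_left ?_ hm.le
    refine lt_of_eq_of_lt ?_ h
    change _ = (e + 2 : ℝ) * (m + 2) * (M.indepSum a e ∅ * M.indepSum a (e + 1 + 1) ∅)
    field_simp
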